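/- **Conventions.** Let $\mathrm G\subset \mathrm{GL}(n)\subset\mathbb R^{n\times n}$ be a connected matrix Lie group (a Lie group whose inclusion in $\mathbb R^{n\times n}$ is an injective homomorphism to $\mathrm{GL}(n)$ and a smooth immersion), with Lie algebra $\mathfrak g=T_I\mathrm G\subset\mathbb R^{n\times n}$; tangent vectors and vector fields are regarded as matrices and matrix-valued functions, $\mathrm D_{\mathtt Y}$ denotes the directional derivative along $\mathtt Y$, and $[\mathtt a,\mathtt b]=\mathtt a\mathtt b-\mathtt b\mathtt a$. A subspace $\mathcal V\subset\mathbb R^{n\times n}$ is *transposable* if $\mathcal V^{\mathsf T}=\mathcal V$. For a transposable subspace $\mathfrak a$, $w\mapsto w_{\mathfrak a}$ is the orthogonal projection of $\mathbb R^{n\times n}$ onto $\mathfrak a$ for the Frobenius inner product $\langle \mathtt b,\mathtt c\rangle_{\mathcal F}=\mathrm{Tr}\,\mathtt b\mathtt c^{\mathsf T}$. If $\mathfrak a\subset\mathfrak g$, put $\mathfrak a_\perp=\{\mathtt h\in\mathfrak g:\mathrm{Tr}\,\mathtt h\mathtt a=0\text{ for all }\mathtt a\in\mathfrak a\}$ and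 let $\mathfrak a_{\bowtie}=[\mathfrak a,\mathfrak a_\perp]$ be the linear span of all $[\mathtt a,\mathtt b]$ with $\mathtt a\in\mathfrak a$, $\mathtt b\in\mathfrak a_\perp$. We write $\mathrm{expm}$ for the matrix exponential and $\mathrm{expa}(A,x)=e^{A}x$ for the exponential of a linear operator $A$ on matrices applied to a matrix $x$. **Theorem.** Assume that $\mathfrak g$ is transposable, and let $\mathfrak a\subset\mathfrak g$ be a transposable Lie subalgebra. Let $\beta_0,\beta_1\in\mathbb R$ with $\beta_0\beta_1\ne0$ and $\beta=\beta_1/\beta_0$. Define on $\mathfrak g$ $$\langle \mathtt g,\mathtt h\rangle_{\vec\beta}=\beta_0\big(\mathrm{Tr}\,\mathtt h\mathtt g-\mathrm{Tr}\,\mathtt h_{\mathfrak a}\mathtt g_{\mathfrak a}\big)-\beta_1\mathrm{Tr}\,\mathtt h_{\mathfrak a}\mathtt g_{\mathfrak a}.$$ 1. This form is symmetric and nondegenerate, and $\langle\xi,\eta\rangle_X=\langle X^{-1}\xi,X^{-1}\eta\rangle_{\vec\beta}$ ($\xi,\eta\in T_X\mathrm G$) is a left-invariant pseudo-Riemannian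 metric on $\mathrm G$. 2. The Levi-Civita connection of this metric exists, is unique, and is $\nabla_{\mathtt Y}\mathtt Z=\mathrm D_{\mathtt Y}\mathtt Z+\Gamma(\mathtt Y,\mathtt Z)$, where for $\xi,\eta\in T_X\mathrm G$ $$\Gamma(\xi,\eta)=-\tfrac12(\xi X^{-1}\eta+\eta X^{-1}\xi)+\tfrac{1+\beta}2X\big([(X^{-1}\xi)_{\mathfrak a},X^{-1}\eta]+[(X^{-1}\eta)_{\mathfrak a},X^{-1}\xi]\big).$$ The last term lies in $X\mathfrak a_{\bowtie}$; indeed $[\mathtt a_{\mathfrak a},\mathtt b]+[\mathtt b_{\mathfrak a},\mathtt a]\in\mathfrak a_{\bowtie}$ for all $\mathtt a,\mathtt b\in\mathfrak g$. 3. Let $X\in\mathrm G$, $\xi\in T_X\mathrm G$, $\mathtt a=X^{-1}\xi$. The geodesic $\gamma$ (a curve with $\ddot\gamma+\Gamma(\dot\gamma,\dot\gamma)=0$) with $\gamma(0)=X$, $\dot\gamma(0)=\xi$ is defined for all $t\in\mathbb R$, is unique on every open interval containing $0$, and is $$\gamma(t)=X\,\mathrm{expm}\big(t(\mathtt a-(1+\beta)\mathtt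 a_{\mathfrak a})\big)\,\mathrm{expm}\big(t(1+\beta)\mathtt a_{\mathfrak a}\big).$$ 4. For $\mathtt b\in\mathfrak g$ let $\mathrm P_{\mathtt a}\mathtt b=\frac12\big([\mathtt b,\mathtt a]+(1+\beta)([\mathtt a_{\mathfrak a},\mathtt b]-[\mathtt b_{\mathfrak a},\mathtt a])\big)$. For $\eta\in T_X\mathrm G$, the parallel transport of $\eta$ along $\gamma$ from $0$ to $t$ (the value at $t$ of the vector field $\Delta$ over $\gamma$ with $\dot\Delta+\Gamma(\dot\gamma,\Delta)=0$, $\Delta(0)=\eta$) exists, is unique, and is $$\mathtt T(\gamma)_0^t\eta=X\,\mathrm{expm}\big(t(\mathtt a-(1+\beta)\mathtt a_{\mathfrak a})\big)\,\mathrm{expa}(t\mathrm P_{\mathtt a},X^{-1}\eta)\,\mathrm{expm}\big(t(1+\beta)\mathtt a_{\mathfrak a}\big).$$ 5. For $\mathtt a\in\mathfrak g$, $\mathrm P_{\mathtt a}$ maps $\mathfrak g$ to $\mathfrak g$, and its adjoint for the Frobenius inner product is $$\mathrm P_{\mathtt a}^{\mathsf T}\mathtt b=\tfrac12\big([\mathtt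 b,\mathtt a^{\mathsf T}]+(1+\beta)([\mathtt a_{\mathfrak a}^{\mathsf T},\mathtt b]-[\mathtt b,\mathtt a^{\mathsf T}]_{\mathfrak a})\big)$$ (which also maps $\mathfrak g$ to $\mathfrak g$; the adjointness holds on all of $\mathbb R^{n\times n}$ when $\mathrm P_{\mathtt a}$ is extended there by the same formula). 6. For $\mathtt a,\mathtt b,\mathtt c\in\mathfrak g$, $\ \langle\mathrm P_{\mathtt a}\mathtt b,\mathtt c\rangle_{\vec\beta}+\langle\mathrm P_{\mathtt a}\mathtt c,\mathtt b\rangle_{\vec\beta}=0$. -/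

import Mathlib

open scoped Manifold ContDiff Matrix
open Set

/- All smoothness notions below are independent of the choice of a norm on the finite-dimensional
space of matrices; we fix the operator norm induced by the Euclidean norm on vectors. -/
open scoped Matrix.Norms.L2Operator

/- The Lie bracket of matrices is the commutator. -/
attribute [local instance] LieRing.ofAssociativeRing

namespace MatrixTransport

noncomputable section

/-- The space of real `n × n` matrices. -/
abbrev Mat (n : ℕ) : Type := Matrix (Fin n) (Fin n) ℝ

/-! ### Transposable subspaces, the Frobenius form and orthogonal projections -/

/-- A space of matrices is transposable if it equals the set of transposes of its elements. -/
def IsTransposable {n : ℕ} (W : Submodule ℝ (Mat n)) : Prop :=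
  (fun a : Mat n => aᵀ) '' (W : Set (Mat n)) = W

/-- The Frobenius inner product `Tr (a bᵀ)`. -/
def frobeniusForm (n : ℕ) : LinearMap.BilinForm ℝ (Mat n) :=
  LinearMap.mk₂ ℝ (fun a b => (a * bᵀ).trace)
    (fun a a' b => by simp [add_mul])
    (fun c a b => by simp)
    (fun a b b' => by simp [mul_add])
    (fun c a b => by simp)

theorem frobeniusForm_apply {n : ℕ} (a b : Mat n) : frobeniusForm n a b = (a * bᵀ).trace := rfl

theorem frobeniusForm_isSymm (n : ℕ) : (frobeniusForm n).IsSymm := by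
  refine ⟨fun a b => ?_⟩
  have h := Matrix.trace_transpose (a * bᵀ)
  rw [Matrix.transpose_mul, Matrix.transpose_transpose] at h
  simp only [frobeniusForm_apply]
  exact h.symm

theorem frobeniusForm_self_eq_zero {n : ℕ} {a : Mat n} (h : frobeniusForm n a a = 0) : a = 0 := by
  rw [frobeniusForm_apply, Matrix.trace_mul_comm, ← Matrix.conjTranspose_eq_transpose_of_trivial]
    at h
  exact Matrix.trace_conjTranspose_mul_self_eq_zero_iff.mp h

theorem isCompl_frobenius_orthogonal {n : ℕ} (W : Submodule ℝ (Mat n)) :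
    IsCompl W ((frobeniusForm n).orthogonal W) := by
  rw [LinearMap.BilinForm.isCompl_orthogonal_iff_disjoint (frobeniusForm_isSymm n).isRefl,
    Submodule.disjoint_def]
  intro x hx hx'
  exact frobeniusForm_self_eq_zero (hx' x hx)

/-- The orthogonal projection `a ↦ a_W` of the space of matrices onto `W`, for the Frobenius
inner product. -/
def proj {n : ℕ} (W : Submodule ℝ (Mat n)) : Mat n →ₗ[ℝ] Mat n :=
  W.subtype ∘ₗ W.projectionOnto _ (isCompl_frobenius_orthogonal W)

/-- The orthogonal complement `𝔞_⊥` of `𝔞` in `𝔤` for the trace form. -/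
def orthoIn {n : ℕ} (𝔤 𝔞 : Submodule ℝ (Mat n)) : Submodule ℝ (Mat n) where
  carrier := {h | h ∈ 𝔤 ∧ ∀ a ∈ 𝔞, (h * a).trace = 0}
  zero_mem' := ⟨𝔤.zero_mem, fun a _ => by simp⟩
  add_mem' := fun {x y} hx hy => ⟨𝔤.add_mem hx.1 hy.1, fun a ha => by
    rw [add_mul, Matrix.trace_add, hx.2 a ha, hy.2 a ha, add_zero]⟩
  smul_mem' := fun c x hx => ⟨𝔤.smul_mem c hx.1, fun a ha => by
    rw [smul_mul_assoc, Matrix.trace_smul, hx.2 a ha, smul_zero]⟩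

/-- The space `𝔞_⋈ = [𝔞, 𝔞_⊥]`, spanned by the brackets of elements of `𝔞` and of `𝔞_⊥`. -/
def bowtie {n : ℕ} (𝔤 𝔞 : Submodule ℝ (Mat n)) : Submodule ℝ (Mat n) :=
  Submodule.span ℝ {x | ∃ a ∈ 𝔞, ∃ b ∈ orthoIn 𝔤 𝔞, x = ⁅a, b⁆}

/-- The bilinear form
`⟨g, h⟩ = β₀ (Tr (h g) - Tr (h_𝔞 g_𝔞)) - β₁ Tr (h_𝔞 g_𝔞)`. -/
def betaForm {n : ℕ} (β₀ β₁ : ℝ) (𝔞 : Submodule ℝ (Mat n)) : LinearMap.BilinForm ℝ (Mat n) :=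
  LinearMap.mk₂ ℝ
    (fun g h => β₀ * ((h * g).trace - (proj 𝔞 h * proj 𝔞 g).trace)
      - β₁ * (proj 𝔞 h * proj 𝔞 g).trace)
    (fun g g' h => by simp [mul_add]; ring)
    (fun c g h => by simp; ring)
    (fun g h h' => by simp [add_mul]; ring)
    (fun c g h => by simp; ring)

/-! ### The operator `P_a` and the exponential action -/

/-- `P_a b = ½ ([b, a] + (1 + β) ([a_𝔞, b] - [b_𝔞, a]))`. -/
def opP {n : ℕ} (β : ℝ) (𝔞 : Submodule ℝ (Mat n)) (a : Mat n) : Mat n →ₗ[ℝ] Mat n where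
  toFun b := (1 / 2 : ℝ) • (⁅b, a⁆ + (1 + β) • (⁅proj 𝔞 a, b⁆ - ⁅proj 𝔞 b, a⁆))
  map_add' b b' := by simp only [map_add, add_lie, lie_add]; module
  map_smul' c b := by simp only [map_smul, smul_lie, lie_smul, RingHom.id_apply]; module

/-- `½ ([b, aᵀ] + (1 + β) ([a_𝔞ᵀ, b] - [b, aᵀ]_𝔞))`. -/
def opPAdj {n : ℕ} (β : ℝ) (𝔞 : Submodule ℝ (Mat n)) (a b : Mat n) : Mat n :=
  (1 / 2 : ℝ) • (⁅b, aᵀ⁆ + (1 + β) • (⁅(proj 𝔞 a)ᵀ, b⁆ - proj 𝔞 ⁅b, aᵀ⁆))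

/-- The exponential action: the exponential of the operator `A`, applied to `x`. -/
def expAct {E : Type*} [NormedAddCommGroup E] [NormedSpace ℝ E] [FiniteDimensional ℝ E]
    (A : E →ₗ[ℝ] E) (x : E) : E :=
  NormedSpace.exp (LinearMap.toContinuousLinearMap A) x

/-! ### Matrix Lie groups -/

/-- A Lie group `G` realized as a Lie subgroup of `GL(n)`: the inclusion is an injective
homomorphism and a smooth immersion. (The subgroup need not be closed.) -/
structure MatrixLieGroup (n : ℕ) (V : Type*) [NormedAddCommGroup V] [NormedSpace ℝ V]
    (G : Type*) [TopologicalSpace G] [ChartedSpace V G] [Group G] [LieGroup 𝓘(ℝ, V) ∞ G] where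
  hom : G →* GL (Fin n) ℝ
  injective : Function.Injective hom
  smooth : ContMDiff 𝓘(ℝ, V) 𝓘(ℝ, Mat n) ∞ (fun X : G => (hom X : Mat n))
  immersion : ∀ X : G, Function.Injective
    (mfderiv 𝓘(ℝ, V) 𝓘(ℝ, Mat n) (fun X : G => (hom X : Mat n)) X)

namespace MatrixLieGroup

variable {n : ℕ} {V : Type*} [NormedAddCommGroup V] [NormedSpace ℝ V]
  {G : Type*} [TopologicalSpace G] [ChartedSpace V G] [Group G] [LieGroup 𝓘(ℝ, V) ∞ G]
  (ι : MatrixLieGroup n V G)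

/-- The matrix of an element of the group. -/
def mat (X : G) : Mat n := (ι.hom X : Mat n)

/-- The differential at `X` of the inclusion of the group into the space of matrices. -/
def diff (X : G) : V →L[ℝ] Mat n := mfderiv 𝓘(ℝ, V) 𝓘(ℝ, Mat n) ι.mat X

/-- The tangent space at `X`, as a space of matrices. -/
def tangentAt (X : G) : Submodule ℝ (Mat n) := LinearMap.range (ι.diff X).toLinearMap

/-- The Lie algebra: the tangent space at the identity. -/
def lieAlg : Submodule ℝ (Mat n) := ι.tangentAt 1

/-- A smooth vector field, as a matrix-valued function with values in the tangent spaces. -/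
def IsVectorField (Y : G → Mat n) : Prop :=
  ContMDiff 𝓘(ℝ, V) 𝓘(ℝ, Mat n) ∞ Y ∧ ∀ X, Y X ∈ ι.tangentAt X

/-- The directional derivative at `X` of a function on the group, in the direction of the
tangent vector represented by the matrix `ξ`. -/
def dirDeriv {F : Type*} [NormedAddCommGroup F] [NormedSpace ℝ F] (f : G → F) (X : G)
    (ξ : Mat n) : F :=
  (mfderiv 𝓘(ℝ, V) 𝓘(ℝ, F) f X : V →L[ℝ] F) (Function.invFun (ι.diff X) ξ)

/-- A pseudo-Riemannian metric: a smooth family of nondegenerate symmetric bilinear forms on the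
tangent spaces. (Only the restriction of `m X` to the tangent space at `X` matters.) -/
structure IsPseudoRiemannianMetric (m : G → LinearMap.BilinForm ℝ (Mat n)) : Prop where
  symm : ∀ X, ((m X).restrict (ι.tangentAt X)).IsSymm
  nondegenerate : ∀ X, ((m X).restrict (ι.tangentAt X)).Nondegenerate
  smooth : ∀ Y Z : G → Mat n, ι.IsVectorField Y → ι.IsVectorField Z →
    ContMDiff 𝓘(ℝ, V) 𝓘(ℝ, ℝ) ∞ (fun X => m X (Y X) (Z X))

/-- Left translations map tangent vectors to tangent vectors and preserve the metric. -/
def IsLeftInvariant (m : G → LinearMap.BilinForm ℝ (Mat n)) : Prop :=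
  ∀ X₁ X : G, ∀ ξ ∈ ι.tangentAt X, ∀ η ∈ ι.tangentAt X,
    ι.mat X₁ * ξ ∈ ι.tangentAt (X₁ * X) ∧ ι.mat X₁ * η ∈ ι.tangentAt (X₁ * X) ∧
    m (X₁ * X) (ι.mat X₁ * ξ) (ι.mat X₁ * η) = m X ξ η

/-- The left-invariant family `⟨ξ, η⟩_X = ⟨X⁻¹ ξ, X⁻¹ η⟩` defined by a bilinear form. -/
def leftInvMetric (B : LinearMap.BilinForm ℝ (Mat n)) (X : G) : LinearMap.BilinForm ℝ (Mat n) :=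
  B.compl₁₂ (LinearMap.mulLeft ℝ (ι.mat X)⁻¹) (LinearMap.mulLeft ℝ (ι.mat X)⁻¹)

/-- A connection (covariant derivative) `(Y, Z) ↦ ∇_Y Z` on smooth vector fields. -/
structure IsConnection (nab : (G → Mat n) → (G → Mat n) → G → Mat n) : Prop where
  isVectorField : ∀ Y Z, ι.IsVectorField Y → ι.IsVectorField Z → ι.IsVectorField (nab Y Z)
  add_left : ∀ Y Y' Z, ι.IsVectorField Y → ι.IsVectorField Y' → ι.IsVectorField Z →
    nab (Y + Y') Z = nab Y Z + nab Y' Z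
  smul_left : ∀ (f : G → ℝ) (Y Z), ContMDiff 𝓘(ℝ, V) 𝓘(ℝ, ℝ) ∞ f →
    ι.IsVectorField Y → ι.IsVectorField Z →
    nab (fun X => f X • Y X) Z = fun X => f X • nab Y Z X
  add_right : ∀ Y Z Z', ι.IsVectorField Y → ι.IsVectorField Z → ι.IsVectorField Z' →
    nab Y (Z + Z') = nab Y Z + nab Y Z'
  leibniz : ∀ (f : G → ℝ) (Y Z), ContMDiff 𝓘(ℝ, V) 𝓘(ℝ, ℝ) ∞ f →
    ι.IsVectorField Y → ι.IsVectorField Z →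
    nab Y (fun X => f X • Z X) = fun X => ι.dirDeriv f X (Y X) • Z X + f X • nab Y Z X

/-- The connection `nab` is the Levi-Civita connection of the metric `m`: it is torsion-free
(the Lie bracket of vector fields is `D_Y Z - D_Z Y`) and compatible with the metric. -/
structure IsLeviCivita (m : G → LinearMap.BilinForm ℝ (Mat n))
    (nab : (G → Mat n) → (G → Mat n) → G → Mat n) : Prop where
  isConnection : ι.IsConnection nab
  torsion_free : ∀ Y Z, ι.IsVectorField Y → ι.IsVectorField Z → ∀ X,
    nab Y Z X - nab Z Y X = ι.dirDeriv Z X (Y X) - ι.dirDeriv Y X (Z X)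
  metric_compatible : ∀ Y Z, ι.IsVectorField Y → ι.IsVectorField Z → ∀ X,
    ι.dirDeriv (fun X' => m X' (Z X') (Z X')) X (Y X) = 2 * m X (Z X) (nab Y Z X)

/-- The operation `(Y, Z) ↦ D_Y Z + Γ(Y, Z)` on matrix-valued functions. -/
def covDeriv (Γ : G → Mat n → Mat n → Mat n) (Y Z : G → Mat n) (X : G) : Mat n :=
  ι.dirDeriv Z X (Y X) + Γ X (Y X) (Z X)

/-- `Γ` is the Christoffel function of the metric `m`: the Levi-Civita connection of `m` is
`∇_Y Z = D_Y Z + Γ(Y, Z)`. -/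
def IsChristoffel (m : G → LinearMap.BilinForm ℝ (Mat n)) (Γ : G → Mat n → Mat n → Mat n) : Prop :=
  ι.IsLeviCivita m (ι.covDeriv Γ)

/-- A curve in the group, seen as a curve of matrices. -/
def curve (γ : ℝ → G) (t : ℝ) : Mat n := ι.mat (γ t)

/-- `γ` restricts to a geodesic of the metric `m` on the open set `J`: it is smooth and
`γ'' + Γ(γ; γ', γ') = 0`, where `Γ` is the Christoffel function of `m`. -/
def IsGeodesicOn (m : G → LinearMap.BilinForm ℝ (Mat n)) (γ : ℝ → G) (J : Set ℝ) : Prop :=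
  ContMDiffOn 𝓘(ℝ, ℝ) 𝓘(ℝ, V) ∞ γ J ∧
  ∃ Γ : G → Mat n → Mat n → Mat n, ι.IsChristoffel m Γ ∧
    ∀ t ∈ J, deriv (deriv (ι.curve γ)) t
      + Γ (γ t) (deriv (ι.curve γ) t) (deriv (ι.curve γ) t) = 0

/-- `Δ` is a smooth vector field over the curve `γ` on the open set `J` that satisfies the
transport equation `Δ' + Γ(γ; γ', Δ) = 0`, where `Γ` is the Christoffel function of `m`. -/
def IsParallelOn (m : G → LinearMap.BilinForm ℝ (Mat n)) (γ : ℝ → G) (Δ : ℝ → Mat n)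
    (J : Set ℝ) : Prop :=
  ContDiffOn ℝ ∞ Δ J ∧ (∀ s ∈ J, Δ s ∈ ι.tangentAt (γ s)) ∧
  ∃ Γ : G → Mat n → Mat n → Mat n, ι.IsChristoffel m Γ ∧
    ∀ s ∈ J, deriv Δ s + Γ (γ s) (deriv (ι.curve γ) s) (Δ s) = 0

/-- `ζ` is a parallel transport of `η` along `γ` from time `0` to time `t`. -/
def IsParallelTransport (m : G → LinearMap.BilinForm ℝ (Mat n)) (γ : ℝ → G) (t : ℝ)
    (η ζ : Mat n) : Prop :=
  ∃ J : Set ℝ, IsOpen J ∧ J.OrdConnected ∧ (0 : ℝ) ∈ J ∧ t ∈ J ∧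
    ∃ Δ : ℝ → Mat n, ι.IsParallelOn m γ Δ J ∧ Δ 0 = η ∧ Δ t = ζ

/-- The term `((1 + β) / 2) X ([(X⁻¹ ξ)_𝔞, X⁻¹ η] + [(X⁻¹ η)_𝔞, X⁻¹ ξ])`. -/
def christoffelTail (β : ℝ) (𝔞 : Submodule ℝ (Mat n)) (X : G) (ξ η : Mat n) : Mat n :=
  ((1 + β) / 2) • (ι.mat X * (⁅proj 𝔞 ((ι.mat X)⁻¹ * ξ), (ι.mat X)⁻¹ * η⁆
    + ⁅proj 𝔞 ((ι.mat X)⁻¹ * η), (ι.mat X)⁻¹ * ξ⁆))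

/-- `Γ(ξ, η) = -½ (ξ X⁻¹ η + η X⁻¹ ξ)
  + ((1 + β) / 2) X ([(X⁻¹ ξ)_𝔞, X⁻¹ η] + [(X⁻¹ η)_𝔞, X⁻¹ ξ])`. -/
def christoffel (β : ℝ) (𝔞 : Submodule ℝ (Mat n)) (X : G) (ξ η : Mat n) : Mat n :=
  -((1 / 2 : ℝ) • (ξ * (ι.mat X)⁻¹ * η + η * (ι.mat X)⁻¹ * ξ)) + ι.christoffelTail β 𝔞 X ξ η

end MatrixLieGroup

end

end MatrixTransport

open MatrixTransport

/-! Everything is transported to the identity. Writing vector fields as `Y X = X * y X`, `Z X = X *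
z X` with `y`, `z` valued in the Lie algebra 𝔤, the operation `D + Γ` becomes the derivative of `z`
along `Y` plus the fixed product `L(y, z) = ½([y, z] + (1 + β)([y_𝔞, z] + [z_𝔞, y]))` (`opL`).
Torsion-freeness is the symmetry of `Γ`. Metric compatibility is the algebraic identity `⟨z, L(y,
z)⟩ = 0` (`betaForm_opL_self`). Uniqueness is Koszul's permutation argument.

The fact that drives the rest is `proj_lie`: for `A ∈ 𝔞`, `ad A` commutes with the projection to 𝔞.
Indeed `ad A` preserves 𝔞 and is skew for the trace form, and transposability makes the Frobenius
projection orthogonal for the trace form too.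

Along a geodesic, `w = γ⁻¹ γ'` satisfies `w' = -L(w, w) = -(1 + β)[w_𝔞, w]`. Projecting, `w_𝔞` is
constant, so with `B = (1 + β) a_𝔞` one gets `w(t) = e^{-tB} a e^{tB}`, and `γ' = γ w` integrates to
a product of two exponentials. A parallel field `Δ = γ d` satisfies `d' = -L(w, d)`. Conjugation by
`e^{tB}` respects `L` (`expConj_opL`) and carries `w` to `a`, so `p = e^{tB} d e^{-tB}` solves the
autonomous equation `p' = [B, p] - L(a, p) = P_a p`. Both operators in `P_a = ad B - L(a, ·)` are
skew for the form, hence so is `P_a`.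

The group need not be closed, so the formulas must be lifted to it: left-invariant fields are
complete, which gives one-parameter subgroups (`exists_curve_eq_exp`). -/

namespace MatrixTransport

/-! ### Projections, the bilinear form and the product `L` on matrices -/

section Algebra

variable {n : ℕ}

theorem proj_mem (W : Submodule ℝ (Mat n)) (x : Mat n) : proj W x ∈ W := by
  simp [proj]

theorem proj_of_mem {W : Submodule ℝ (Mat n)} {x : Mat n} (hx : x ∈ W) : proj W x = x := by
  have := Submodule.projectionOnto_apply_left (isCompl_frobenius_orthogonal W) ⟨x, hx⟩
  simp only [proj, LinearMap.comp_apply, this, Submodule.subtype_apply]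

theorem sub_proj_mem_orthogonal (W : Submodule ℝ (Mat n)) (x : Mat n) :
    x - proj W x ∈ (frobeniusForm n).orthogonal W := by
  rw [← Submodule.ker_projectionOnto (isCompl_frobenius_orthogonal W), LinearMap.mem_ker, map_sub,
    sub_eq_zero]
  exact (Submodule.projectionOnto_apply_left (isCompl_frobenius_orthogonal W) _).symm

theorem transpose_mem {W : Submodule ℝ (Mat n)} (hW : IsTransposable W) {x : Mat n} (hx : x ∈ W) :
    xᵀ ∈ W := by
  have : xᵀ ∈ (W : Set (Mat n)) := by
    rw [← hW]
    exact ⟨x, hx, rfl⟩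
  exact this

theorem frobeniusForm_sub_proj (W : Submodule ℝ (Mat n)) (x : Mat n) {w : Mat n} (hw : w ∈ W) :
    frobeniusForm n w (x - proj W x) = 0 :=
  sub_proj_mem_orthogonal W x w hw

theorem proj_eq_of_orthogonal {W : Submodule ℝ (Mat n)} {x y : Mat n} (hy : y ∈ W)
    (h : ∀ w ∈ W, frobeniusForm n w (x - y) = 0) : proj W x = y := by
  rw [← sub_eq_zero]
  have hm : proj W x - y ∈ W := W.sub_mem (proj_mem W x) hy
  refine frobeniusForm_self_eq_zero ?_
  have h1 := h _ hm
  have h2 := frobeniusForm_sub_proj W x hm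
  have : proj W x - y = (x - y) - (x - proj W x) := by abel
  calc _ = frobeniusForm n (proj W x - y) ((x - y) - (x - proj W x)) := by rw [← this]
    _ = 0 := by rw [map_sub, h1, h2, sub_zero]

/-- For a transposable subspace the remainder of the projection is orthogonal to the subspace
for the trace form. -/
theorem trace_sub_proj_mul {W : Submodule ℝ (Mat n)} (hW : IsTransposable W) (x : Mat n) {w : Mat n}
    (hw : w ∈ W) : ((x - proj W x) * w).trace = 0 := by
  have := frobeniusForm_sub_proj W x (transpose_mem hW hw)
  rwa [(frobeniusForm_isSymm n).eq, frobeniusForm_apply, Matrix.transpose_transpose] at this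

/-- As `w` runs over a transposable subspace so does `wᵀ`, so orthogonality may be tested with the
trace form, which interacts well with commutators. -/
theorem proj_eq_of_trace {W : Submodule ℝ (Mat n)} (hW : IsTransposable W) {x y : Mat n}
    (hy : y ∈ W) (h : ∀ w ∈ W, ((x - y) * w).trace = 0) : proj W x = y := by
  refine proj_eq_of_orthogonal hy fun w hw => ?_
  rw [(frobeniusForm_isSymm n).eq, frobeniusForm_apply]
  exact h _ (transpose_mem hW hw)

theorem trace_mul_proj {W : Submodule ℝ (Mat n)} (hW : IsTransposable W) (x : Mat n) {w : Mat n}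
    (hw : w ∈ W) : (proj W x * w).trace = (x * w).trace := by
  have := trace_sub_proj_mul hW x hw
  rw [sub_mul, Matrix.trace_sub, sub_eq_zero] at this
  exact this.symm

theorem proj_transpose {W : Submodule ℝ (Mat n)} (hW : IsTransposable W) (x : Mat n) :
    proj W xᵀ = (proj W x)ᵀ := by
  refine proj_eq_of_orthogonal (transpose_mem hW (proj_mem W x)) fun w hw => ?_
  have := frobeniusForm_sub_proj W x (transpose_mem hW hw)
  rw [frobeniusForm_apply] at this ⊢
  rw [← Matrix.transpose_sub, Matrix.transpose_transpose, ← Matrix.trace_transpose,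
    Matrix.transpose_mul, Matrix.trace_mul_comm]
  exact this

theorem proj_proj (W : Submodule ℝ (Mat n)) (x : Mat n) : proj W (proj W x) = proj W x :=
  proj_of_mem (proj_mem W x)

theorem trace_mul_lie (a b c : Mat n) : (a * ⁅b, c⁆).trace = (⁅a, b⁆ * c).trace := by
  simp only [Ring.lie_def, mul_sub, sub_mul, Matrix.trace_sub, ← mul_assoc]
  congr 1
  rw [mul_assoc b, Matrix.trace_mul_comm b]

theorem lie_mem_of_subalgebra {𝔞 : LieSubalgebra ℝ (Mat n)} {a b : Mat n} (ha : a ∈ 𝔞.toSubmodule)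
    (hb : b ∈ 𝔞.toSubmodule) : ⁅a, b⁆ ∈ 𝔞.toSubmodule :=
  𝔞.lie_mem ha hb

/-- Since `ad A` is skew for the trace form and preserves 𝔞, it also preserves the complement of 𝔞,
and therefore commutes with the projection. -/
theorem proj_lie {𝔞 : LieSubalgebra ℝ (Mat n)} (h𝔞 : IsTransposable 𝔞.toSubmodule) (x : Mat n)
    {A : Mat n} (hA : A ∈ 𝔞.toSubmodule) :
    proj 𝔞.toSubmodule ⁅x, A⁆ = ⁅proj 𝔞.toSubmodule x, A⁆ := by
  refine proj_eq_of_trace h𝔞 (lie_mem_of_subalgebra (proj_mem _ _) hA) fun w hw => ?_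
  rw [← sub_lie, ← trace_mul_lie]
  exact trace_sub_proj_mul h𝔞 x (lie_mem_of_subalgebra hA hw)

theorem betaForm_apply (β₀ β₁ : ℝ) (𝔞 : Submodule ℝ (Mat n)) (g h : Mat n) :
    betaForm β₀ β₁ 𝔞 g h = β₀ * ((h * g).trace - (proj 𝔞 h * proj 𝔞 g).trace)
      - β₁ * (proj 𝔞 h * proj 𝔞 g).trace := rfl

theorem betaForm_symm (β₀ β₁ : ℝ) (𝔞 : Submodule ℝ (Mat n)) (g h : Mat n) :
    betaForm β₀ β₁ 𝔞 g h = betaForm β₀ β₁ 𝔞 h g := by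
  rw [betaForm_apply, betaForm_apply, Matrix.trace_mul_comm h g,
    Matrix.trace_mul_comm (proj 𝔞 h) (proj 𝔞 g)]

/-- One of the two projections is redundant under the trace, and `β₀ + β₁ = β₀ (1 + β)`. -/
theorem betaForm_eq {β₀ β₁ β : ℝ} (hβ : β₀ * β = β₁) {𝔞 : Submodule ℝ (Mat n)}
    (h𝔞 : IsTransposable 𝔞) (g h : Mat n) :
    betaForm β₀ β₁ 𝔞 g h = β₀ * ((h * g).trace - (1 + β) * (h * proj 𝔞 g).trace) := by
  rw [betaForm_apply, trace_mul_proj h𝔞 h (proj_mem 𝔞 g), ← hβ]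
  ring

/-- Testing against transposes turns the indefinite trace form into the Frobenius norm. The test
element `(g_𝔞)ᵀ` leaves `-β₁ ‖g_𝔞‖²`; once `g_𝔞 = 0`, the test element `gᵀ` leaves `β₀ ‖g‖²`. -/
theorem betaForm_separating {β₀ β₁ : ℝ} (hβ : β₀ * β₁ ≠ 0) {𝔤 𝔞 : Submodule ℝ (Mat n)}
    (h𝔤 : IsTransposable 𝔤) (h𝔞𝔤 : 𝔞 ≤ 𝔤) (h𝔞 : IsTransposable 𝔞) {g : Mat n} (hg : g ∈ 𝔤)
    (h : ∀ x ∈ 𝔤, betaForm β₀ β₁ 𝔞 g x = 0) : g = 0 := by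
  obtain ⟨h0, h1⟩ := mul_ne_zero_iff.mp hβ
  have hpm := proj_mem 𝔞 g
  have hA : proj 𝔞 g = 0 := by
    refine frobeniusForm_self_eq_zero ?_
    have := h _ (h𝔞𝔤 (transpose_mem h𝔞 hpm))
    rw [betaForm_apply, proj_transpose h𝔞, proj_proj, Matrix.trace_mul_comm _ g,
      ← trace_mul_proj h𝔞 g (transpose_mem h𝔞 hpm), Matrix.trace_mul_comm _ (proj 𝔞 g)] at this
    rw [frobeniusForm_apply]
    simpa [h1] using this
  refine frobeniusForm_self_eq_zero ?_
  have := h _ (transpose_mem h𝔤 hg)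
  rw [betaForm_apply, hA, mul_zero, Matrix.trace_zero, mul_zero, sub_zero, sub_zero,
    Matrix.trace_mul_comm] at this
  rw [frobeniusForm_apply]
  simpa [h0] using this

/-- The product `½ ([a, b] + (1 + β) ([a_𝔞, b] + [b_𝔞, a]))` describing the connection in the left
trivialization. -/
noncomputable def opL (β : ℝ) (𝔞 : Submodule ℝ (Mat n)) (a b : Mat n) : Mat n :=
  (1 / 2 : ℝ) • (⁅a, b⁆ + (1 + β) • (⁅proj 𝔞 a, b⁆ + ⁅proj 𝔞 b, a⁆))

theorem opL_add_right (β : ℝ) (𝔞 : Submodule ℝ (Mat n)) (a b c : Mat n) :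
    opL β 𝔞 a (b + c) = opL β 𝔞 a b + opL β 𝔞 a c := by
  simp only [opL, map_add, add_lie, lie_add]; module

theorem trace_mul_lie_self (a b : Mat n) : (a * ⁅a, b⁆).trace = 0 := by
  rw [trace_mul_lie, lie_self, zero_mul, Matrix.trace_zero]

theorem trace_mul_lie_self' (a b : Mat n) : (a * ⁅b, a⁆).trace = 0 := by
  rw [← lie_skew, mul_neg, Matrix.trace_neg, trace_mul_lie_self, neg_zero]

variable {𝔞 : LieSubalgebra ℝ (Mat n)}

/-- This is metric compatibility in the left trivialization. With `τ = Tr [z, z_𝔞] y`, one finds `Tr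
z L = ½ (1 + β) τ` and `Tr z_𝔞 L = ½ τ`, which cancel in `betaForm_eq`; this is what fixes the
coefficient `(1 + β) / 2` in `Γ`. -/
theorem betaForm_opL_self {β₀ β₁ β : ℝ} (hβ : β₀ * β = β₁)
    (h𝔞 : IsTransposable 𝔞.toSubmodule) (y z : Mat n) :
    betaForm β₀ β₁ 𝔞.toSubmodule z (opL β 𝔞.toSubmodule y z) = 0 := by
  rw [betaForm_eq hβ h𝔞, opL]
  set p := proj 𝔞.toSubmodule with hp
  have e1 : (z * ⁅p z, y⁆).trace = (⁅z, p z⁆ * y).trace := trace_mul_lie _ _ _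
  have e2 : (p z * ⁅y, z⁆).trace = (⁅z, p z⁆ * y).trace := by
    rw [trace_mul_lie, Matrix.trace_mul_comm, trace_mul_lie]
  -- The bracket `[z_𝔞, y_𝔞]` lies in the subalgebra, so under the trace `z` may be replaced by
  -- `z_𝔞`.
  have e3 : (p z * ⁅p y, z⁆).trace = 0 := by
    rw [trace_mul_lie, Matrix.trace_mul_comm, ← trace_mul_proj h𝔞 z
      (lie_mem_of_subalgebra (proj_mem _ _) (proj_mem _ _)), trace_mul_lie_self]
  rw [Matrix.trace_mul_comm, Matrix.trace_mul_comm _ (p z)]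
  simp only [mul_add, mul_smul_comm, Matrix.trace_add, Matrix.trace_smul, e1, e2, e3,
    trace_mul_lie_self, trace_mul_lie_self', smul_eq_mul]
  ring

/-- Polarization of `betaForm_opL_self`. -/
theorem betaForm_opL {β₀ β₁ β : ℝ} (hβ : β₀ * β = β₁)
    (h𝔞 : IsTransposable 𝔞.toSubmodule) (y z w : Mat n) :
    betaForm β₀ β₁ 𝔞.toSubmodule z (opL β 𝔞.toSubmodule y w)
      + betaForm β₀ β₁ 𝔞.toSubmodule w (opL β 𝔞.toSubmodule y z) = 0 := by
  have h1 := betaForm_opL_self hβ h𝔞 y (z + w)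
  rw [opL_add_right, map_add, map_add, LinearMap.add_apply, LinearMap.add_apply,
    betaForm_opL_self hβ h𝔞, betaForm_opL_self hβ h𝔞] at h1
  linarith

/-- `ad A` is skew for the trace form and, for `A ∈ 𝔞`, commutes with the projection, so it is skew
for both traces that make up the form. -/
theorem betaForm_lie {β₀ β₁ : ℝ} (h𝔞 : IsTransposable 𝔞.toSubmodule) {A : Mat n}
    (hA : A ∈ 𝔞.toSubmodule) (b c : Mat n) :
    betaForm β₀ β₁ 𝔞.toSubmodule ⁅A, b⁆ c + betaForm β₀ β₁ 𝔞.toSubmodule ⁅A, c⁆ b = 0 := by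
  have e : ∀ x : Mat n, proj 𝔞.toSubmodule ⁅A, x⁆ = ⁅A, proj 𝔞.toSubmodule x⁆ := fun x => by
    rw [← lie_skew, map_neg, proj_lie h𝔞 x hA, lie_skew]
  have t : ∀ x y : Mat n, (x * ⁅A, y⁆).trace = - (y * ⁅A, x⁆).trace := fun x y => by
    rw [trace_mul_lie, ← lie_skew, neg_mul, Matrix.trace_neg, Matrix.trace_mul_comm]
  rw [betaForm_apply, betaForm_apply, e, e, t c b, t (proj 𝔞.toSubmodule c)]
  ring

/-- This splits `P_a` into the rotation `ad ((1 + β) a_𝔞)` of the moving frame and the connection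
term. Both its skewness and its role in parallel transport are read off from this form. -/
theorem opP_eq (β : ℝ) (W : Submodule ℝ (Mat n)) (a b : Mat n) :
    opP β W a b = (1 + β) • ⁅proj W a, b⁆ - opL β W a b := by
  change (1 / 2 : ℝ) • (⁅b, a⁆ + (1 + β) • (⁅proj W a, b⁆ - ⁅proj W b, a⁆)) = _
  rw [opL, ← lie_skew]
  module

theorem betaForm_opP {β₀ β₁ β : ℝ} (hβ : β₀ * β = β₁)
    (h𝔞 : IsTransposable 𝔞.toSubmodule) (a b c : Mat n) :
    betaForm β₀ β₁ 𝔞.toSubmodule (opP β 𝔞.toSubmodule a b) c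
      + betaForm β₀ β₁ 𝔞.toSubmodule (opP β 𝔞.toSubmodule a c) b = 0 := by
  have h1 := betaForm_opL hβ h𝔞 a b c
  have h2 := betaForm_lie (β₀ := β₀) (β₁ := β₁) h𝔞 (proj_mem 𝔞.toSubmodule a) b c
  rw [betaForm_symm _ _ _ b, betaForm_symm _ _ _ c] at h1
  simp only [opP_eq, map_sub, map_smul, LinearMap.sub_apply, LinearMap.smul_apply, smul_eq_mul]
  linear_combination (1 + β) * h2 - h1

theorem frobeniusForm_lie_left (a b c : Mat n) :
    frobeniusForm n ⁅a, c⁆ b = frobeniusForm n c ⁅aᵀ, b⁆ := by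
  simp only [frobeniusForm_apply, Ring.lie_def, Matrix.transpose_sub, Matrix.transpose_mul,
    Matrix.transpose_transpose, mul_sub, sub_mul, Matrix.trace_sub]
  congr 1
  · rw [mul_assoc, Matrix.trace_mul_comm, mul_assoc]
  · rw [mul_assoc]

theorem frobeniusForm_proj (W : Submodule ℝ (Mat n)) (x y : Mat n) :
    frobeniusForm n (proj W x) y = frobeniusForm n x (proj W y) := by
  have h1 := frobeniusForm_sub_proj W y (proj_mem W x)
  have h2 := frobeniusForm_sub_proj W x (proj_mem W y)
  rw [map_sub, sub_eq_zero] at h1 h2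
  rw [h1, (frobeniusForm_isSymm n).eq x, h2, (frobeniusForm_isSymm n).eq]

/-- Term by term: the adjoint of `ad a` is `ad aᵀ`, and the projection is self-adjoint. -/
theorem frobeniusForm_opP (β : ℝ) (W : Submodule ℝ (Mat n)) (a b c : Mat n) :
    frobeniusForm n (opP β W a c) b = frobeniusForm n c (opPAdj β W a b) := by
  change frobeniusForm n ((1 / 2 : ℝ) • (⁅c, a⁆ + (1 + β) • (⁅proj W a, c⁆ - ⁅proj W c, a⁆))) b = _
  rw [opPAdj, ← lie_skew c a, ← lie_skew (proj W c) a, ← lie_skew b aᵀ]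
  simp only [map_smul, map_add, map_sub, map_neg, LinearMap.smul_apply, LinearMap.add_apply,
    LinearMap.sub_apply, LinearMap.neg_apply, frobeniusForm_lie_left, frobeniusForm_proj]

theorem lie_proj_add_mem_bowtie {𝔤 W : Submodule ℝ (Mat n)} (hW𝔤 : W ≤ 𝔤) (hW : IsTransposable W)
    {a b : Mat n} (ha : a ∈ 𝔤) (hb : b ∈ 𝔤) : ⁅proj W a, b⁆ + ⁅proj W b, a⁆ ∈ bowtie 𝔤 W := by
  have key : ∀ x ∈ 𝔤, ∀ y : Mat n, ⁅proj W y, x - proj W x⁆ ∈ bowtie 𝔤 W := fun x hx y =>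
    Submodule.subset_span ⟨_, proj_mem W y, _,
      ⟨𝔤.sub_mem hx (hW𝔤 (proj_mem W x)), fun w hw => trace_sub_proj_mul hW x hw⟩, rfl⟩
  -- The brackets of the 𝔞-components, `[a_𝔞, b_𝔞]` and `[b_𝔞, a_𝔞]`, cancel, so only components
  -- orthogonal to 𝔞 remain in the second slots.
  have e : ⁅proj W a, b⁆ + ⁅proj W b, a⁆
      = ⁅proj W a, b - proj W b⁆ + ⁅proj W b, a - proj W a⁆ := by
    rw [lie_sub, lie_sub, ← lie_skew (proj W b) (proj W a)]
    abel
  rw [e]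
  exact (bowtie 𝔤 W).add_mem (key b hb a) (key a ha b)

end Algebra

/-! ### Derivatives of vector-valued functions on a manifold -/

section ManifoldDerivative

variable {V : Type*} [NormedAddCommGroup V] [NormedSpace ℝ V]
  {G : Type*} [TopologicalSpace G] [ChartedSpace V G]
  {F : Type*} [NormedAddCommGroup F] [NormedSpace ℝ F]
  {E : Type*} [NormedAddCommGroup E] [NormedSpace ℝ E]
  {H : Type*} [NormedAddCommGroup H] [NormedSpace ℝ H]

/-- The derivative of a vector-valued function on a manifold modelled on `V`, as a linear map
from `V`. -/
noncomputable def mder (f : G → F) (X : G) : V →L[ℝ] F := mfderiv 𝓘(ℝ, V) 𝓘(ℝ, F) f X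

theorem hasFDerivAt_comp_chart {f : G → F} {X : G} (h : MDifferentiableAt 𝓘(ℝ, V) 𝓘(ℝ, F) f X) :
    HasFDerivAt (f ∘ (chartAt V X).symm) (mder f X) (chartAt V X X) := by
  have := h.hasMFDerivAt.2
  simp only [mfld_simps] at this
  exact hasFDerivWithinAt_univ.mp this

theorem mdifferentiableAt_and_mder_eq {f : G → F} {X : G} {f' : V →L[ℝ] F} (hc : ContinuousAt f X)
    (h : HasFDerivAt (f ∘ (chartAt V X).symm) f' (chartAt V X X)) :
    MDifferentiableAt 𝓘(ℝ, V) 𝓘(ℝ, F) f X ∧ mder f X = f' := by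
  have h' : HasMFDerivAt 𝓘(ℝ, V) 𝓘(ℝ, F) f X f' := by
    refine ⟨hc, ?_⟩
    simp only [mfld_simps]
    exact hasFDerivWithinAt_univ.mpr h
  exact ⟨h'.mdifferentiableAt, h'.mfderiv⟩

theorem mder_add {f g : G → F} {X : G} (hf : MDifferentiableAt 𝓘(ℝ, V) 𝓘(ℝ, F) f X)
    (hg : MDifferentiableAt 𝓘(ℝ, V) 𝓘(ℝ, F) g X) :
    mder (fun x => f x + g x) X = (mder f X + mder g X : V →L[ℝ] F) :=
  (mdifferentiableAt_and_mder_eq (hf.continuousAt.add hg.continuousAt)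
    ((hasFDerivAt_comp_chart hf).add (hasFDerivAt_comp_chart hg))).2

theorem mder_clm (L : F →L[ℝ] E) {f : G → F} {X : G}
    (hf : MDifferentiableAt 𝓘(ℝ, V) 𝓘(ℝ, F) f X) :
    mder (fun x => L (f x)) X = (L.comp (mder f X) : V →L[ℝ] E) :=
  (mdifferentiableAt_and_mder_eq (L.continuous.continuousAt.comp hf.continuousAt)
    (L.hasFDerivAt.comp _ (hasFDerivAt_comp_chart hf))).2

theorem mder_bilin (B : E →L[ℝ] F →L[ℝ] H) {f : G → E} {g : G → F} {X : G}
    (hf : MDifferentiableAt 𝓘(ℝ, V) 𝓘(ℝ, E) f X)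
    (hg : MDifferentiableAt 𝓘(ℝ, V) 𝓘(ℝ, F) g X) (v : V) :
    mder (fun x => B (f x) (g x)) X v = B (f X) (mder g X v) + B (mder f X v) (g X) := by
  have h := B.hasFDerivAt_of_bilinear (hasFDerivAt_comp_chart hf) (hasFDerivAt_comp_chart hg)
  have hc : ContinuousAt (fun x => B (f x) (g x)) X :=
    (B.continuous.continuousAt.comp hf.continuousAt).clm_apply hg.continuousAt
  rw [(mdifferentiableAt_and_mder_eq hc h).2]
  simp

/-- The derivative of a map between manifolds modelled on `V`, as a linear map of `V`. -/
noncomputable def mmap {G' : Type*} [TopologicalSpace G'] [ChartedSpace V G'] (φ : G' → G)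
    (X : G') : V →L[ℝ] V := mfderiv 𝓘(ℝ, V) 𝓘(ℝ, V) φ X

theorem mder_comp_map {G' : Type*} [TopologicalSpace G'] [ChartedSpace V G'] {φ : G' → G}
    {f : G → F} {X : G'} (hf : MDifferentiableAt 𝓘(ℝ, V) 𝓘(ℝ, F) f (φ X))
    (hφ : MDifferentiableAt 𝓘(ℝ, V) 𝓘(ℝ, V) φ X) (v : V) :
    mder (fun x => f (φ x)) X v
      = mder f (φ X) (mmap φ X v) := by
  have h : mder (fun x => f (φ x)) X = ((mder f (φ X)).comp (mmap φ X) : V →L[ℝ] F) :=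
    mfderiv_comp X hf hφ
  rw [h, ContinuousLinearMap.comp_apply]

theorem hasDerivAt_comp_curve {γ : ℝ → G} {f : G → F} {t : ℝ}
    (hf : MDifferentiableAt 𝓘(ℝ, V) 𝓘(ℝ, F) f (γ t)) {v : V}
    (hγ : HasMFDerivAt 𝓘(ℝ, ℝ) 𝓘(ℝ, V) γ t
      ((1 : ℝ →L[ℝ] ℝ).smulRight v : ℝ →L[ℝ] V)) :
    HasDerivAt (fun s => f (γ s)) (mder f (γ t) v) t := by
  have h : HasFDerivAt (fun s => f (γ s))
      ((mder f (γ t)).comp ((1 : ℝ →L[ℝ] ℝ).smulRight v)) t :=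
    hasMFDerivAt_iff_hasFDerivAt.mp (hf.hasMFDerivAt.comp t hγ)
  simpa using h.hasDerivAt

/-- Differentiating `f = proj W ∘ f` shows that the derivative is fixed by the projection. -/
theorem mder_mem {n : ℕ} {W : Submodule ℝ (Mat n)} {f : G → Mat n} {X : G}
    (hf : MDifferentiableAt 𝓘(ℝ, V) 𝓘(ℝ, Mat n) f X) (h : ∀ x, f x ∈ W) (v : V) :
    mder f X v ∈ W := by
  have h1 := mder_clm (LinearMap.toContinuousLinearMap (proj W)) hf
  have h2 : (fun x => LinearMap.toContinuousLinearMap (proj W) (f x)) = f :=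
    funext fun x => proj_of_mem (h x)
  rw [h2] at h1
  rw [h1]
  exact proj_mem _ _

end ManifoldDerivative

/-! ### Smoothness and product rules for matrix-valued functions -/

section BilinearSmooth

variable {V : Type*} [NormedAddCommGroup V] [NormedSpace ℝ V]
  {G : Type*} [TopologicalSpace G] [ChartedSpace V G]
  {F : Type*} [NormedAddCommGroup F] [NormedSpace ℝ F]
  {E : Type*} [NormedAddCommGroup E] [NormedSpace ℝ E]
  {H : Type*} [NormedAddCommGroup H] [NormedSpace ℝ H]

theorem _root_.ContMDiff.mdifferentiableAt_infty {f : G → F} (hf : ContMDiff 𝓘(ℝ, V) 𝓘(ℝ, F) ∞ f)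
    (X : G) : MDifferentiableAt 𝓘(ℝ, V) 𝓘(ℝ, F) f X :=
  hf.mdifferentiable (by simp) X

theorem contMDiff_bilin (B : E →L[ℝ] F →L[ℝ] H) {f : G → E} {g : G → F}
    (hf : ContMDiff 𝓘(ℝ, V) 𝓘(ℝ, E) ∞ f) (hg : ContMDiff 𝓘(ℝ, V) 𝓘(ℝ, F) ∞ g) :
    ContMDiff 𝓘(ℝ, V) 𝓘(ℝ, H) ∞ (fun x => B (f x) (g x)) :=
  B.isBoundedBilinearMap.contDiff.comp_contMDiff (hf.prodMk_space hg)

theorem contMDiff_clm (L : E →L[ℝ] F) {f : G → E} (hf : ContMDiff 𝓘(ℝ, V) 𝓘(ℝ, E) ∞ f) :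
    ContMDiff 𝓘(ℝ, V) 𝓘(ℝ, F) ∞ (fun x => L (f x)) :=
  L.contDiff.comp_contMDiff hf

theorem contMDiff_matrix_mul {n : ℕ} {f g : G → Mat n} (hf : ContMDiff 𝓘(ℝ, V) 𝓘(ℝ, Mat n) ∞ f)
    (hg : ContMDiff 𝓘(ℝ, V) 𝓘(ℝ, Mat n) ∞ g) :
    ContMDiff 𝓘(ℝ, V) 𝓘(ℝ, Mat n) ∞ (fun x => f x * g x) :=
  contMDiff_bilin (ContinuousLinearMap.mul ℝ (Mat n)) hf hg

theorem mder_matrix_mul {n : ℕ} {f g : G → Mat n} {X : G}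
    (hf : MDifferentiableAt 𝓘(ℝ, V) 𝓘(ℝ, Mat n) f X)
    (hg : MDifferentiableAt 𝓘(ℝ, V) 𝓘(ℝ, Mat n) g X) (v : V) :
    mder (fun x => f x * g x) X v = f X * mder g X v + mder f X v * g X :=
  mder_bilin (ContinuousLinearMap.mul ℝ (Mat n)) hf hg v

theorem mder_const (c : F) (X : G) : mder (fun _ : G => c) X = (0 : V →L[ℝ] F) :=
  mfderiv_const

theorem contMDiff_opL (β : ℝ) (W : Submodule ℝ (Mat n)) {y z : G → Mat n}
    (hy : ContMDiff 𝓘(ℝ, V) 𝓘(ℝ, Mat n) ∞ y) (hz : ContMDiff 𝓘(ℝ, V) 𝓘(ℝ, Mat n) ∞ z) :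
    ContMDiff 𝓘(ℝ, V) 𝓘(ℝ, Mat n) ∞ (fun X => opL β W (y X) (z X)) := by
  have hp : ∀ {y : G → Mat n}, ContMDiff 𝓘(ℝ, V) 𝓘(ℝ, Mat n) ∞ y →
      ContMDiff 𝓘(ℝ, V) 𝓘(ℝ, Mat n) ∞ (fun X => proj W (y X)) :=
    fun hy => contMDiff_clm (LinearMap.toContinuousLinearMap (proj W)) hy
  have hl : ∀ {y z : G → Mat n}, ContMDiff 𝓘(ℝ, V) 𝓘(ℝ, Mat n) ∞ y →
      ContMDiff 𝓘(ℝ, V) 𝓘(ℝ, Mat n) ∞ z →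
      ContMDiff 𝓘(ℝ, V) 𝓘(ℝ, Mat n) ∞ (fun X => ⁅y X, z X⁆) := fun hy hz => by
    simp only [Ring.lie_def]
    exact (contMDiff_matrix_mul hy hz).sub (contMDiff_matrix_mul hz hy)
  have hc : ∀ (r : ℝ) {y : G → Mat n}, ContMDiff 𝓘(ℝ, V) 𝓘(ℝ, Mat n) ∞ y →
      ContMDiff 𝓘(ℝ, V) 𝓘(ℝ, Mat n) ∞ (fun X => r • y X) :=
    fun r _ hy => contMDiff_clm (r • ContinuousLinearMap.id ℝ (Mat n)) hy
  exact hc _ ((hl hy hz).add (hc _ ((hl (hp hy) hz).add (hl (hp hz) hy))))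

end BilinearSmooth

/-! ### Translations of tangent spaces and the Lie algebra of the group -/

namespace MatrixLieGroup

variable {n : ℕ} {V : Type*} [NormedAddCommGroup V] [NormedSpace ℝ V]
  {G : Type*} [TopologicalSpace G] [ChartedSpace V G] [Group G] [LieGroup 𝓘(ℝ, V) ∞ G]
  (ι : MatrixLieGroup n V G)
  {F : Type*} [NormedAddCommGroup F] [NormedSpace ℝ F]

theorem mat_mul (X Y : G) : ι.mat (X * Y) = ι.mat X * ι.mat Y := by simp [mat]

theorem mat_one : ι.mat 1 = 1 := by simp [mat]

theorem mat_inv (X : G) : ι.mat X⁻¹ = (ι.mat X)⁻¹ := by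
  simp only [mat, map_inv, Matrix.coe_units_inv]

theorem mat_mul_inv (X : G) : ι.mat X * (ι.mat X)⁻¹ = 1 := by
  rw [← mat_inv, ← mat_mul, mul_inv_cancel, mat_one]

theorem inv_mul_mat (X : G) : (ι.mat X)⁻¹ * ι.mat X = 1 := by
  rw [← mat_inv, ← mat_mul, inv_mul_cancel, mat_one]

theorem mat_mul_inv_cancel_left (X : G) (a : Mat n) : ι.mat X * ((ι.mat X)⁻¹ * a) = a := by
  rw [← mul_assoc, mat_mul_inv, one_mul]

theorem inv_mul_mat_cancel_left (X : G) (a : Mat n) : (ι.mat X)⁻¹ * (ι.mat X * a) = a := by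
  rw [← mul_assoc, inv_mul_mat, one_mul]

theorem mat_injective : Function.Injective ι.mat := fun _ _ h => ι.injective (Units.ext h)

theorem contMDiff_mat : ContMDiff 𝓘(ℝ, V) 𝓘(ℝ, Mat n) ∞ ι.mat := ι.smooth

theorem contMDiff_mat_inv : ContMDiff 𝓘(ℝ, V) 𝓘(ℝ, Mat n) ∞ (fun X => (ι.mat X)⁻¹) := by
  simp only [← mat_inv]
  exact ι.contMDiff_mat.comp (contMDiff_inv 𝓘(ℝ, V) ∞)

theorem mdifferentiableAt_mul_left (g X : G) :
    MDifferentiableAt 𝓘(ℝ, V) 𝓘(ℝ, V) (fun x : G => g * x) X :=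
  (contMDiff_mul_left (I := 𝓘(ℝ, V)) (n := ∞)).mdifferentiable (by simp) X

theorem mdifferentiableAt_mul_right (g X : G) :
    MDifferentiableAt 𝓘(ℝ, V) 𝓘(ℝ, V) (fun x : G => x * g) X :=
  (contMDiff_mul_right (I := 𝓘(ℝ, V)) (n := ∞)).mdifferentiable (by simp) X

theorem diff_eq_mder (X : G) : ι.diff X = mder ι.mat X := rfl

theorem diff_injective (X : G) : Function.Injective (ι.diff X) := ι.immersion X

theorem dirDeriv_diff (f : G → F) (X : G) (v : V) : ι.dirDeriv f X (ι.diff X v) = mder f X v :=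
  congrArg (fun w : V => mder f X w) (Function.leftInverse_invFun (ι.diff_injective X) v)

/-- Differentiate `mat (g * x) = mat g * mat x` in `x`. Thus matrix multiplication realizes the
tangent map of a left translation. -/
theorem mat_mul_diff (g X : G) (v : V) :
    ι.mat g * ι.diff X v = ι.diff (g * X) (mmap (fun x => g * x) X v) := by
  have h1 := mder_comp_map (ι.contMDiff_mat.mdifferentiableAt_infty (g * X))
    (mdifferentiableAt_mul_left g X) v
  have h2 := mder_matrix_mul (contMDiff_const (c := ι.mat g) |>.mdifferentiableAt_infty X)
    (ι.contMDiff_mat.mdifferentiableAt_infty X) v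
  simp only [mat_mul] at h1
  rw [h1, mder_const] at h2
  simpa [diff_eq_mder] using h2.symm

theorem diff_mul_mat (g X : G) (v : V) :
    ι.diff X v * ι.mat g = ι.diff (X * g) (mmap (fun x => x * g) X v) := by
  have h1 := mder_comp_map (φ := fun x => x * g) (ι.contMDiff_mat.mdifferentiableAt_infty (X * g))
    (mdifferentiableAt_mul_right g X) v
  have h2 := mder_matrix_mul (ι.contMDiff_mat.mdifferentiableAt_infty X)
    (contMDiff_const (c := ι.mat g) |>.mdifferentiableAt_infty X) v
  simp only [mat_mul] at h1
  rw [h1, mder_const] at h2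
  simpa [diff_eq_mder] using h2.symm

theorem diff_mem (X : G) (v : V) : ι.diff X v ∈ ι.tangentAt X := ⟨v, rfl⟩

theorem exists_diff_eq {X : G} {ξ : Mat n} (h : ξ ∈ ι.tangentAt X) : ∃ v, ι.diff X v = ξ := h

theorem mat_mul_mem (g : G) {X : G} {ξ : Mat n} (h : ξ ∈ ι.tangentAt X) :
    ι.mat g * ξ ∈ ι.tangentAt (g * X) := by
  obtain ⟨v, rfl⟩ := ι.exists_diff_eq h
  rw [mat_mul_diff]
  exact ι.diff_mem _ _

theorem mul_mat_mem (g : G) {X : G} {ξ : Mat n} (h : ξ ∈ ι.tangentAt X) :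
    ξ * ι.mat g ∈ ι.tangentAt (X * g) := by
  obtain ⟨v, rfl⟩ := ι.exists_diff_eq h
  rw [diff_mul_mat]
  exact ι.diff_mem _ _

theorem mat_mul_mem_tangentAt (X : G) {a : Mat n} (h : a ∈ ι.lieAlg) :
    ι.mat X * a ∈ ι.tangentAt X := by
  have := ι.mat_mul_mem X h
  rwa [mul_one] at this

theorem inv_mul_mem_lieAlg {X : G} {ξ : Mat n} (h : ξ ∈ ι.tangentAt X) :
    (ι.mat X)⁻¹ * ξ ∈ ι.lieAlg := by
  have := ι.mat_mul_mem X⁻¹ h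
  rwa [inv_mul_cancel, mat_inv] at this

theorem conj_mem_lieAlg (X : G) {a : Mat n} (h : a ∈ ι.lieAlg) :
    ι.mat X * a * (ι.mat X)⁻¹ ∈ ι.lieAlg := by
  have := ι.mul_mat_mem X⁻¹ (ι.mat_mul_mem X h)
  rwa [mul_one, mul_inv_cancel, mat_inv] at this

theorem mder_mat_inv_one (v : V) : mder (fun X => (ι.mat X)⁻¹) 1 v = - ι.diff 1 v := by
  have h := mder_matrix_mul (ι.contMDiff_mat.mdifferentiableAt_infty 1)
    (ι.contMDiff_mat_inv.mdifferentiableAt_infty 1) v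
  simp only [mat_mul_inv, mder_const, mat_one, inv_one, one_mul, mul_one] at h
  exact eq_neg_of_add_eq_zero_left h.symm

/-- The tangent space at the identity is closed under the commutator. -/
theorem lie_mem_lieAlg {a b : Mat n} (ha : a ∈ ι.lieAlg) (hb : b ∈ ι.lieAlg) :
    ⁅a, b⁆ ∈ ι.lieAlg := by
  obtain ⟨v, rfl⟩ := ι.exists_diff_eq ha
  -- The map `X ↦ X b X⁻¹` takes values in the Lie algebra, hence so does its derivative at `1`
  -- along `a`, which is `a b - b a`.
  have hs := contMDiff_matrix_mul ι.contMDiff_mat (contMDiff_const (c := b))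
  have h1 := mder_mem ((contMDiff_matrix_mul hs ι.contMDiff_mat_inv).mdifferentiableAt_infty 1)
    (fun X => ι.conj_mem_lieAlg X hb) v
  rw [mder_matrix_mul (hs.mdifferentiableAt_infty 1)
    (ι.contMDiff_mat_inv.mdifferentiableAt_infty 1),
    mder_matrix_mul (ι.contMDiff_mat.mdifferentiableAt_infty 1)
    (contMDiff_const.mdifferentiableAt_infty 1), mder_mat_inv_one, mder_const, mat_one] at h1
  rw [Ring.lie_def]
  convert h1 using 1
  simp [diff_eq_mder]
  abel

/-- The Hausdorff property is pulled back from the matrices; it serves the extension of integral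
curves. -/
theorem t2Space (ι : MatrixLieGroup n V G) : T2Space G :=
  T2Space.of_injective_continuous ι.mat_injective ι.contMDiff_mat.continuous

/-! ### Directional derivatives -/

theorem dirDeriv_add_vec (f : G → F) {X : G} {ξ η : Mat n} (hξ : ξ ∈ ι.tangentAt X)
    (hη : η ∈ ι.tangentAt X) :
    ι.dirDeriv f X (ξ + η) = ι.dirDeriv f X ξ + ι.dirDeriv f X η := by
  obtain ⟨v, rfl⟩ := ι.exists_diff_eq hξ
  obtain ⟨w, rfl⟩ := ι.exists_diff_eq hη
  rw [← map_add (ι.diff X), dirDeriv_diff, dirDeriv_diff, dirDeriv_diff, map_add]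

theorem dirDeriv_smul_vec (f : G → F) {X : G} {ξ : Mat n} (hξ : ξ ∈ ι.tangentAt X) (r : ℝ) :
    ι.dirDeriv f X (r • ξ) = r • ι.dirDeriv f X ξ := by
  obtain ⟨v, rfl⟩ := ι.exists_diff_eq hξ
  rw [← map_smul (ι.diff X), dirDeriv_diff, dirDeriv_diff, map_smul]

theorem dirDeriv_add {f g : G → F} (hf : ContMDiff 𝓘(ℝ, V) 𝓘(ℝ, F) ∞ f)
    (hg : ContMDiff 𝓘(ℝ, V) 𝓘(ℝ, F) ∞ g) {X : G} (ξ : Mat n) :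
    ι.dirDeriv (fun x => f x + g x) X ξ = ι.dirDeriv f X ξ + ι.dirDeriv g X ξ :=
  congrArg (fun L : V →L[ℝ] F => L _)
    (mder_add (hf.mdifferentiableAt_infty X) (hg.mdifferentiableAt_infty X))

theorem dirDeriv_bilin {E H : Type*} [NormedAddCommGroup E] [NormedSpace ℝ E]
    [NormedAddCommGroup H] [NormedSpace ℝ H] (B : E →L[ℝ] F →L[ℝ] H) {f : G → E} {g : G → F}
    (hf : ContMDiff 𝓘(ℝ, V) 𝓘(ℝ, E) ∞ f) (hg : ContMDiff 𝓘(ℝ, V) 𝓘(ℝ, F) ∞ g) (X : G)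
    (ξ : Mat n) :
    ι.dirDeriv (fun x => B (f x) (g x)) X ξ
      = B (f X) (ι.dirDeriv g X ξ) + B (ι.dirDeriv f X ξ) (g X) :=
  mder_bilin B (hf.mdifferentiableAt_infty X) (hg.mdifferentiableAt_infty X) _

theorem dirDeriv_mat {X : G} {ξ : Mat n} (hξ : ξ ∈ ι.tangentAt X) : ι.dirDeriv ι.mat X ξ = ξ := by
  obtain ⟨v, rfl⟩ := ι.exists_diff_eq hξ
  rw [dirDeriv_diff, diff_eq_mder]

theorem dirDeriv_mem {W : Submodule ℝ (Mat n)} {f : G → Mat n}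
    (hf : ContMDiff 𝓘(ℝ, V) 𝓘(ℝ, Mat n) ∞ f) (h : ∀ x, f x ∈ W) (X : G) (ξ : Mat n) :
    ι.dirDeriv f X ξ ∈ W :=
  mder_mem (hf.mdifferentiableAt_infty X) h _

theorem dirDeriv_mat_mul {z : G → Mat n} (hz : ContMDiff 𝓘(ℝ, V) 𝓘(ℝ, Mat n) ∞ z) {X : G}
    {ξ : Mat n} (hξ : ξ ∈ ι.tangentAt X) :
    ι.dirDeriv (fun x => ι.mat x * z x) X ξ = ι.mat X * ι.dirDeriv z X ξ + ξ * z X := by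
  have := ι.dirDeriv_bilin (ContinuousLinearMap.mul ℝ (Mat n)) ι.contMDiff_mat hz X ξ
  rw [dirDeriv_mat ι hξ] at this
  exact this

/-- The derivative of a smooth function along a smooth vector field, given in the left
trivialization, is smooth. -/
theorem contMDiff_dirDeriv {f : G → F} {y : G → Mat n} (hf : ContMDiff 𝓘(ℝ, V) 𝓘(ℝ, F) ∞ f)
    [FiniteDimensional ℝ V]
    (hy : ContMDiff 𝓘(ℝ, V) 𝓘(ℝ, Mat n) ∞ y) (hy' : ∀ X, y X ∈ ι.lieAlg) :
    ContMDiff 𝓘(ℝ, V) 𝓘(ℝ, F) ∞ (fun X => ι.dirDeriv f X (ι.mat X * y X)) := by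
  have : IsTopologicalGroup G := topologicalGroup_of_lieGroup 𝓘(ℝ, V) ∞
  obtain ⟨P, hP⟩ := (ι.diff 1).toLinearMap.exists_leftInverse_of_injective
    (LinearMap.ker_eq_bot.mpr (ι.diff_injective 1))
  have hP' : ∀ v, P (ι.diff 1 v) = v := fun v => LinearMap.congr_fun hP v
  set Q : Mat n →L[ℝ] V := LinearMap.toContinuousLinearMap P
  have hc : ∀ X, HasFDerivAt (fun v : V => f (X * (chartAt V (1 : G)).symm v))
      (mder (fun g => f (X * g)) 1) (chartAt V (1 : G) 1) := fun X =>
    hasFDerivAt_comp_chart (hf.comp (contMDiff_mul_left (I := 𝓘(ℝ, V)) (n := ∞))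
      |>.mdifferentiableAt_infty 1)
  -- Pulling back by the translation by `X` moves the differentiation to a fixed point in a fixed
  -- chart at `1`, with `X` as a parameter. Joint smoothness in parameter and chart variable then
  -- suffices. The left inverse `Q` of the differential reads the direction off the matrix.
  have key : ∀ X, ι.dirDeriv f X (ι.mat X * y X)
      = fderiv ℝ (fun v : V => f (X * (chartAt V (1 : G)).symm v)) (chartAt V (1 : G) 1)
        (Q (y X)) := by
    intro X
    rw [(hc X).fderiv]
    obtain ⟨v, hv⟩ := ι.exists_diff_eq (hy' X)
    rw [← hv, mat_mul_diff, mul_one]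
    rw [dirDeriv_diff]
    have h3 : Q (ι.diff 1 v) = v := hP' v
    rw [h3, mder_comp_map (hf.mdifferentiableAt_infty _) (mdifferentiableAt_mul_left X 1), mul_one]
  simp only [key]
  intro X₀
  have hsymm : ContMDiffAt 𝓘(ℝ, V) 𝓘(ℝ, V) ∞ (chartAt V (1 : G)).symm (chartAt V (1 : G) 1) :=
    (contMDiffOn_chart_symm (I := 𝓘(ℝ, V)) (x := (1 : G)) (n := ∞)).contMDiffAt
      ((chartAt V (1 : G)).open_target.mem_nhds (mem_chart_target V 1))
  have hu : ContMDiffAt (𝓘(ℝ, V).prod 𝓘(ℝ, V)) 𝓘(ℝ, F) ∞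
      (Function.uncurry fun (X : G) (v : V) => f (X * (chartAt V (1 : G)).symm v))
      (X₀, chartAt V (1 : G) 1) := by
    refine hf.contMDiffAt.comp _ (ContMDiffAt.mul contMDiffAt_fst ?_)
    exact ContMDiffAt.comp (X₀, chartAt V (1 : G) 1) hsymm contMDiffAt_snd
  have := ContMDiffAt.mfderiv_apply (m := ∞)
    (fun (X : G) (v : V) => f (X * (chartAt V (1 : G)).symm v)) (fun _ => chartAt V (1 : G) 1) id
    (fun X => Q (y X)) (x₀ := X₀) hu contMDiffAt_const contMDiffAt_id
    (contMDiff_clm Q hy).contMDiffAt (by simp)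
  simp only [inTangentCoordinates_model_space, mfderiv_eq_fderiv] at this
  exact this

/-! ### Vector fields in the left trivialization -/

theorem isVectorField_mat_mul {z : G → Mat n} (hz : ContMDiff 𝓘(ℝ, V) 𝓘(ℝ, Mat n) ∞ z)
    (hz' : ∀ X, z X ∈ ι.lieAlg) : ι.IsVectorField (fun X => ι.mat X * z X) :=
  ⟨contMDiff_matrix_mul ι.contMDiff_mat hz, fun X => ι.mat_mul_mem_tangentAt X (hz' X)⟩

theorem IsVectorField.exists_eq_mat_mul {Y : G → Mat n} (hY : ι.IsVectorField Y) :
    ∃ y : G → Mat n, ContMDiff 𝓘(ℝ, V) 𝓘(ℝ, Mat n) ∞ y ∧ (∀ X, y X ∈ ι.lieAlg) ∧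
      Y = fun X => ι.mat X * y X :=
  ⟨fun X => (ι.mat X)⁻¹ * Y X, contMDiff_matrix_mul ι.contMDiff_mat_inv hY.1,
    fun X => ι.inv_mul_mem_lieAlg (hY.2 X), funext fun X => (ι.mat_mul_inv_cancel_left X _).symm⟩

/-- Every tangent vector extends to a left-invariant vector field. -/
theorem exists_isVectorField_apply_eq {X : G} {ξ : Mat n} (hξ : ξ ∈ ι.tangentAt X) :
    ∃ Y, ι.IsVectorField Y ∧ Y X = ξ :=
  ⟨_, ι.isVectorField_mat_mul (z := fun _ => (ι.mat X)⁻¹ * ξ) contMDiff_const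
    (fun _ => ι.inv_mul_mem_lieAlg hξ), ι.mat_mul_inv_cancel_left X ξ⟩

end MatrixLieGroup

namespace MatrixLieGroup

variable {n : ℕ} {V : Type*} [NormedAddCommGroup V] [NormedSpace ℝ V]
  {G : Type*} [TopologicalSpace G] [ChartedSpace V G] [Group G] [LieGroup 𝓘(ℝ, V) ∞ G]
  (ι : MatrixLieGroup n V G)

/-! ### Left-invariant metrics -/

theorem leftInvMetric_apply (B : LinearMap.BilinForm ℝ (Mat n)) (X : G) (ξ η : Mat n) :
    ι.leftInvMetric B X ξ η = B ((ι.mat X)⁻¹ * ξ) ((ι.mat X)⁻¹ * η) := rfl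

theorem leftInvMetric_mat_mul (B : LinearMap.BilinForm ℝ (Mat n)) (X : G) (a b : Mat n) :
    ι.leftInvMetric B X (ι.mat X * a) (ι.mat X * b) = B a b := by
  rw [leftInvMetric_apply, inv_mul_mat_cancel_left, inv_mul_mat_cancel_left]

theorem isLeftInvariant_leftInvMetric (B : LinearMap.BilinForm ℝ (Mat n)) :
    ι.IsLeftInvariant (ι.leftInvMetric B) := by
  intro X₁ X ξ hξ η hη
  refine ⟨ι.mat_mul_mem X₁ hξ, ι.mat_mul_mem X₁ hη, ?_⟩
  have h : ∀ x : Mat n, (ι.mat (X₁ * X))⁻¹ * (ι.mat X₁ * x) = (ι.mat X)⁻¹ * x := fun x => by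
    rw [← mat_inv, mul_inv_rev, mat_mul, mat_inv, mat_inv, mul_assoc, inv_mul_mat_cancel_left]
  rw [leftInvMetric_apply, leftInvMetric_apply, h, h]

theorem isPseudoRiemannianMetric_leftInvMetric {B : LinearMap.BilinForm ℝ (Mat n)}
    (hs : ∀ a b, B a b = B b a) (hn : ∀ a ∈ ι.lieAlg, (∀ b ∈ ι.lieAlg, B a b = 0) → a = 0) :
    ι.IsPseudoRiemannianMetric (ι.leftInvMetric B) := by
  have key : ∀ X : G, ∀ ξ ∈ ι.tangentAt X,
      (∀ η ∈ ι.tangentAt X, ι.leftInvMetric B X ξ η = 0) → ξ = 0 := by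
    intro X ξ hξ h
    have h0 := hn _ (ι.inv_mul_mem_lieAlg hξ) fun b hb => by
      have := h _ (ι.mat_mul_mem_tangentAt X hb)
      rwa [leftInvMetric_apply, inv_mul_mat_cancel_left] at this
    rw [← ι.mat_mul_inv_cancel_left X ξ, h0, mul_zero]
  have hsym : ∀ X : G, ∀ ξ η, ι.leftInvMetric B X ξ η = ι.leftInvMetric B X η ξ :=
    fun X ξ η => hs _ _
  refine ⟨fun X => ⟨fun ξ η => hsym X ξ η⟩, fun X => ⟨fun ξ h => ?_, fun ξ h => ?_⟩, ?_⟩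
  · exact Subtype.ext (key X ξ ξ.2 fun η hη => h ⟨η, hη⟩)
  · exact Subtype.ext (key X ξ ξ.2 fun η hη => (hsym X _ _).trans (h ⟨η, hη⟩))
  · intro Y Z hY hZ
    exact contMDiff_bilin (LinearMap.toContinuousBilinearMap B)
      (contMDiff_matrix_mul ι.contMDiff_mat_inv hY.1)
      (contMDiff_matrix_mul ι.contMDiff_mat_inv hZ.1)

/-! ### Operations on vector fields -/

variable {ι}

theorem IsVectorField.add {Y Z : G → Mat n} (hY : ι.IsVectorField Y) (hZ : ι.IsVectorField Z) :
    ι.IsVectorField (Y + Z) :=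
  ⟨hY.1.add hZ.1, fun X => (ι.tangentAt X).add_mem (hY.2 X) (hZ.2 X)⟩

theorem IsVectorField.smul {f : G → ℝ} (hf : ContMDiff 𝓘(ℝ, V) 𝓘(ℝ, ℝ) ∞ f) {Y : G → Mat n}
    (hY : ι.IsVectorField Y) : ι.IsVectorField (fun X => f X • Y X) :=
  ⟨contMDiff_bilin (ContinuousLinearMap.lsmul ℝ ℝ) hf hY.1,
    fun X => (ι.tangentAt X).smul_mem _ (hY.2 X)⟩

/-- The axioms only see `nab` on smooth vector fields, so the connection is characterized by its
values there. -/
theorem IsLeviCivita.congr {m : G → LinearMap.BilinForm ℝ (Mat n)}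
    {nab nab' : (G → Mat n) → (G → Mat n) → G → Mat n} (h : ι.IsLeviCivita m nab)
    (he : ∀ Y Z, ι.IsVectorField Y → ι.IsVectorField Z → nab' Y Z = nab Y Z) :
    ι.IsLeviCivita m nab' where
  isConnection :=
    { isVectorField := fun Y Z hY hZ => by
        rw [he Y Z hY hZ]; exact h.isConnection.isVectorField Y Z hY hZ
      add_left := fun Y Y' Z hY hY' hZ => by
        rw [he _ _ (hY.add hY') hZ, he _ _ hY hZ, he _ _ hY' hZ]
        exact h.isConnection.add_left Y Y' Z hY hY' hZ
      smul_left := fun f Y Z hf hY hZ => by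
        rw [he _ _ (hY.smul hf) hZ, he _ _ hY hZ]
        exact h.isConnection.smul_left f Y Z hf hY hZ
      add_right := fun Y Z Z' hY hZ hZ' => by
        rw [he _ _ hY (hZ.add hZ'), he _ _ hY hZ, he _ _ hY hZ']
        exact h.isConnection.add_right Y Z Z' hY hZ hZ'
      leibniz := fun f Y Z hf hY hZ => by
        rw [he _ _ hY (hZ.smul hf), he _ _ hY hZ]
        exact h.isConnection.leibniz f Y Z hf hY hZ }
  torsion_free := fun Y Z hY hZ X => by
    rw [he _ _ hY hZ, he _ _ hZ hY]; exact h.torsion_free Y Z hY hZ X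
  metric_compatible := fun Y Z hY hZ X => by
    rw [he _ _ hY hZ]; exact h.metric_compatible Y Z hY hZ X

/-- The Levi-Civita connection is unique. -/
theorem IsLeviCivita.unique {m : G → LinearMap.BilinForm ℝ (Mat n)}
    (hm : ι.IsPseudoRiemannianMetric m) {nab nab' : (G → Mat n) → (G → Mat n) → G → Mat n}
    (h : ι.IsLeviCivita m nab) (h' : ι.IsLeviCivita m nab') {Y Z : G → Mat n}
    (hY : ι.IsVectorField Y) (hZ : ι.IsVectorField Z) : nab Y Z = nab' Y Z := by
  funext X
  -- At `X`, the difference `D` of the connections is symmetric by torsion-freeness, while `m (Z,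
  -- D(Y, W))` is antisymmetric in `Z` and `W` by compatibility.
  set D : (G → Mat n) → (G → Mat n) → Mat n := fun Y Z => nab Y Z X - nab' Y Z X with hD
  have hsymm : ∀ Y Z, ι.IsVectorField Y → ι.IsVectorField Z → D Y Z = D Z Y := by
    intro Y Z hY hZ
    have h1 := h.torsion_free Y Z hY hZ X
    rw [← h'.torsion_free Y Z hY hZ X] at h1
    simp only [hD]
    rw [sub_eq_sub_iff_add_eq_add] at h1 ⊢
    rw [h1]
    abel
  have hself : ∀ Y Z, ι.IsVectorField Y → ι.IsVectorField Z → m X (Z X) (D Y Z) = 0 := by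
    intro Y Z hY hZ
    have h1 := h.metric_compatible Y Z hY hZ X
    rw [h'.metric_compatible Y Z hY hZ X] at h1
    simp only [hD, map_sub]
    linarith
  have hanti : ∀ Y Z W, ι.IsVectorField Y → ι.IsVectorField Z → ι.IsVectorField W →
      m X (Z X) (D Y W) = - m X (W X) (D Y Z) := by
    intro Y Z W hY hZ hW
    have h1 := hself Y (Z + W) hY (hZ.add hW)
    have h2 : D Y (Z + W) = D Y Z + D Y W := by
      simp only [hD, h.isConnection.add_right Y Z W hY hZ hW,
        h'.isConnection.add_right Y Z W hY hZ hW, Pi.add_apply]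
      abel
    rw [h2, Pi.add_apply, map_add, map_add, LinearMap.add_apply, LinearMap.add_apply,
      hself Y Z hY hZ, hself Y W hY hW] at h1
    linarith
  have hDm : D Y Z ∈ ι.tangentAt X := (ι.tangentAt X).sub_mem
    ((h.isConnection.isVectorField Y Z hY hZ).2 X) ((h'.isConnection.isVectorField Y Z hY hZ).2 X)
  have hz : (⟨D Y Z, hDm⟩ : ι.tangentAt X) = 0 := by
    refine (hm.nondegenerate X).2 _ fun w => ?_
    obtain ⟨W, hW, hWX⟩ := ι.exists_isVectorField_apply_eq w.2
    change m X w (D Y Z) = 0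
    rw [← hWX]
    -- Three antisymmetries alternating with three symmetries return `m (W, D(Y, Z))` to itself with
    -- the opposite sign.
    have e1 := hanti Y W Z hY hW hZ
    have e2 := hanti W Z Y hW hZ hY
    have e3 := hanti Z Y W hZ hY hW
    rw [hsymm Y W hY hW] at e1
    rw [hsymm W Y hW hY, hsymm W Z hW hZ] at e2
    rw [hsymm Z Y hZ hY] at e3
    rw [hsymm W Y hW hY] at e1
    linarith
  exact sub_eq_zero.mp (congrArg Subtype.val hz)

variable (ι)

/-! ### The Christoffel function -/

/-- The symmetric term is `-½(yz + zy) = ½[y, z] - yz`. The leftover `-yz` cancels the derivative of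
the factor `X` in `D_Y (X z)`. -/
theorem christoffel_mat_mul (β : ℝ) (W : Submodule ℝ (Mat n)) (X : G) (y z : Mat n) :
    ι.christoffel β W X (ι.mat X * y) (ι.mat X * z)
      = ι.mat X * opL β W y z - ι.mat X * (y * z) := by
  rw [christoffel, christoffelTail]
  simp only [inv_mul_mat_cancel_left]
  have e : ∀ y z : Mat n, ι.mat X * y * (ι.mat X)⁻¹ * (ι.mat X * z) = ι.mat X * (y * z) :=
    fun y z => by rw [mul_assoc, inv_mul_mat_cancel_left, mul_assoc]
  rw [e, e, opL, Ring.lie_def y z]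
  simp only [mul_smul_comm, mul_add, mul_sub]
  module

theorem christoffel_comm (β : ℝ) (W : Submodule ℝ (Mat n)) (X : G) (ξ η : Mat n) :
    ι.christoffel β W X ξ η = ι.christoffel β W X η ξ := by
  rw [christoffel, christoffel, christoffelTail, christoffelTail,
    add_comm (ξ * (ι.mat X)⁻¹ * η), add_comm ⁅proj W ((ι.mat X)⁻¹ * ξ), (ι.mat X)⁻¹ * η⁆]

theorem christoffel_add_right (β : ℝ) (W : Submodule ℝ (Mat n)) (X : G) (ξ η ζ : Mat n) :
    ι.christoffel β W X ξ (η + ζ) = ι.christoffel β W X ξ η + ι.christoffel β W X ξ ζ := by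
  simp only [christoffel, christoffelTail, mul_add, add_mul, map_add, lie_add, add_lie]
  module

theorem christoffel_smul_right (β : ℝ) (W : Submodule ℝ (Mat n)) (X : G) (r : ℝ) (ξ η : Mat n) :
    ι.christoffel β W X ξ (r • η) = r • ι.christoffel β W X ξ η := by
  simp only [christoffel, christoffelTail, mul_smul_comm, smul_mul_assoc, map_smul, lie_smul,
    smul_lie, mul_add]
  module

theorem covDeriv_christoffel_mat_mul (β : ℝ) (W : Submodule ℝ (Mat n)) {y z : G → Mat n}
    (hy : ∀ X, y X ∈ ι.lieAlg) (hz : ContMDiff 𝓘(ℝ, V) 𝓘(ℝ, Mat n) ∞ z) (X : G) :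
    ι.covDeriv (ι.christoffel β W) (fun X => ι.mat X * y X) (fun X => ι.mat X * z X) X
      = ι.mat X * (ι.dirDeriv z X (ι.mat X * y X) + opL β W (y X) (z X)) := by
  rw [covDeriv, christoffel_mat_mul, dirDeriv_mat_mul ι hz (ι.mat_mul_mem_tangentAt X (hy X)),
    mul_add, mul_assoc]
  abel

theorem opL_mem (β : ℝ) {W : Submodule ℝ (Mat n)} (hW : W ≤ ι.lieAlg) {y z : Mat n}
    (hy : y ∈ ι.lieAlg) (hz : z ∈ ι.lieAlg) : opL β W y z ∈ ι.lieAlg :=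
  ι.lieAlg.smul_mem _ (ι.lieAlg.add_mem (ι.lie_mem_lieAlg hy hz)
    (ι.lieAlg.smul_mem _ (ι.lieAlg.add_mem (ι.lie_mem_lieAlg (hW (proj_mem W y)) hz)
      (ι.lie_mem_lieAlg (hW (proj_mem W z)) hy))))

theorem isLeviCivita_christoffel [FiniteDimensional ℝ V] {𝔞 : LieSubalgebra ℝ (Mat n)}
    (h𝔞𝔤 : 𝔞.toSubmodule ≤ ι.lieAlg) (h𝔞 : IsTransposable 𝔞.toSubmodule) {β₀ β₁ β : ℝ}
    (hβ : β₀ * β = β₁) :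
    ι.IsLeviCivita (ι.leftInvMetric (betaForm β₀ β₁ 𝔞.toSubmodule))
      (ι.covDeriv (ι.christoffel β 𝔞.toSubmodule)) where
  isConnection :=
    { isVectorField := fun Y Z hY hZ => by
        obtain ⟨y, hy, hy', rfl⟩ := hY.exists_eq_mat_mul
        obtain ⟨z, hz, hz', rfl⟩ := hZ.exists_eq_mat_mul
        rw [show ι.covDeriv (ι.christoffel β 𝔞.toSubmodule) _ _ = _ from
          funext (ι.covDeriv_christoffel_mat_mul β 𝔞.toSubmodule hy' hz)]
        exact ι.isVectorField_mat_mul ((ι.contMDiff_dirDeriv hz hy hy').add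
          (contMDiff_opL β _ hy hz))
          fun X => ι.lieAlg.add_mem (ι.dirDeriv_mem hz hz' X _) (ι.opL_mem β h𝔞𝔤 (hy' X) (hz' X))
      add_left := fun Y Y' Z hY hY' hZ => by
        funext X
        simp only [covDeriv, Pi.add_apply]
        rw [dirDeriv_add_vec ι Z (hY.2 X) (hY'.2 X), christoffel_comm, christoffel_add_right,
          christoffel_comm, christoffel_comm ι β _ X (Z X)]
        abel
      smul_left := fun f Y Z hf hY hZ => by
        funext X
        simp only [covDeriv]
        rw [dirDeriv_smul_vec ι Z (hY.2 X), christoffel_comm, christoffel_smul_right,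
          christoffel_comm, smul_add]
      add_right := fun Y Z Z' hY hZ hZ' => by
        funext X
        simp only [covDeriv, Pi.add_apply]
        rw [christoffel_add_right]
        have := ι.dirDeriv_add hZ.1 hZ'.1 (X := X) (Y X)
        rw [show Z + Z' = fun x => Z x + Z' x from rfl, this]
        abel
      leibniz := fun f Y Z hf hY hZ => by
        funext X
        simp only [covDeriv]
        have := ι.dirDeriv_bilin (ContinuousLinearMap.lsmul ℝ ℝ) hf hZ.1 X (Y X)
        simp only [ContinuousLinearMap.lsmul_apply] at this
        rw [this, christoffel_smul_right, smul_add]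
        abel }
  torsion_free := fun Y Z hY hZ X => by
    simp only [covDeriv]
    rw [christoffel_comm ι β _ X (Z X)]
    abel
  metric_compatible := fun Y Z hY hZ X => by
    obtain ⟨y, hy, hy', rfl⟩ := hY.exists_eq_mat_mul
    obtain ⟨z, hz, hz', rfl⟩ := hZ.exists_eq_mat_mul
    rw [covDeriv_christoffel_mat_mul ι β 𝔞.toSubmodule hy' hz]
    simp only [leftInvMetric_mat_mul]
    have := ι.dirDeriv_bilin (LinearMap.toContinuousBilinearMap (betaForm β₀ β₁ 𝔞.toSubmodule))
      hz hz X (ι.mat X * y X)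
    simp only [LinearMap.toContinuousBilinearMap_apply] at this
    -- The derivative of `⟨z, z⟩` is `2⟨z, D_Y z⟩`, so compatibility reduces to the vanishing of
    -- `⟨z, L(y, z)⟩`.
    rw [this, map_add, betaForm_opL_self hβ h𝔞, betaForm_symm _ _ _ _ (z X)]
    ring

end MatrixLieGroup

/-! ### Linear differential equations with constant coefficients -/

section Exponential

variable {𝔸 : Type*} [NormedRing 𝔸] [NormedAlgebra ℝ 𝔸] [CompleteSpace 𝔸]

theorem exp_smul_mul_exp_neg_smul (a : 𝔸) (t : ℝ) :
    NormedSpace.exp (t • a) * NormedSpace.exp ((-t) • a) = 1 := by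
  let _ : NormedAlgebra ℚ 𝔸 := NormedAlgebra.restrictScalars ℚ ℝ 𝔸
  rw [← NormedSpace.exp_add_of_commute ((Commute.refl a).smul_left _ |>.smul_right _), ← add_smul,
    add_neg_cancel, zero_smul, NormedSpace.exp_zero]

theorem exp_neg_smul_mul_exp_smul (a : 𝔸) (t : ℝ) :
    NormedSpace.exp ((-t) • a) * NormedSpace.exp (t • a) = 1 := by
  have := exp_smul_mul_exp_neg_smul a (-t)
  rwa [neg_neg] at this

theorem hasDerivAt_exp_neg_smul (a : 𝔸) (t : ℝ) :
    HasDerivAt (fun u : ℝ => NormedSpace.exp ((-u) • a)) (-(a * NormedSpace.exp ((-t) • a))) t := by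
  have h := (hasDerivAt_exp_smul_const' a (-t)).scomp t (hasDerivAt_neg t)
  rw [neg_one_smul] at h
  exact h

theorem contDiff_exp_smul (a : 𝔸) : ContDiff ℝ ∞ (fun t : ℝ => NormedSpace.exp (t • a)) :=
  contDiff_iff_contDiffAt.mpr fun t => (NormedSpace.exp_analytic (𝕂 := ℝ) (t • a)).contDiffAt.comp t
    (contDiff_id.smul contDiff_const).contDiffAt

theorem eq_of_hasDerivAt_zero {E : Type*} [NormedAddCommGroup E] [NormedSpace ℝ E] {f : ℝ → E}
    {J : Set ℝ} (hJ : IsOpen J) (hJ' : J.OrdConnected) (h0 : (0 : ℝ) ∈ J)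
    (hf : ∀ t ∈ J, HasDerivAt f 0 t) {t : ℝ} (ht : t ∈ J) : f t = f 0 :=
  hJ.is_const_of_deriv_eq_zero hJ'.isPreconnected
    (fun s hs => (hf s hs).differentiableAt.differentiableWithinAt) (fun s hs => (hf s hs).deriv)
    ht h0

/-- Solutions of `c' = c a` are given by the exponential. -/
theorem eq_mul_exp_of_hasDerivAt {c : ℝ → 𝔸} {a : 𝔸}
    {J : Set ℝ} (hJ : IsOpen J) (hJ' : J.OrdConnected) (h0 : (0 : ℝ) ∈ J)
    (hc : ∀ t ∈ J, HasDerivAt c (c t * a) t) {t : ℝ} (ht : t ∈ J) :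
    c t = c 0 * NormedSpace.exp (t • a) := by
  -- Integrating factor: `c e^{-ta}` has zero derivative.
  have h := eq_of_hasDerivAt_zero (f := fun t => c t * NormedSpace.exp ((-t) • a)) hJ hJ' h0
    (fun s hs => by
      convert! (hc s hs).mul (hasDerivAt_exp_neg_smul a s) using 1
      simp [mul_assoc]) ht
  simp only [neg_zero, zero_smul, NormedSpace.exp_zero, mul_one] at h
  rw [← h, mul_assoc, exp_neg_smul_mul_exp_smul, mul_one]

end Exponential

/-! ### The exponential of a linear operator -/

section ExpAct

variable {E : Type*} [NormedAddCommGroup E] [NormedSpace ℝ E] [FiniteDimensional ℝ E]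

theorem expAct_smul (A : E →ₗ[ℝ] E) (t : ℝ) (x : E) :
    expAct (t • A) x = NormedSpace.exp (t • LinearMap.toContinuousLinearMap A) x := by
  rw [expAct, map_smul]

theorem expAct_zero_smul (A : E →ₗ[ℝ] E) (x : E) : expAct ((0 : ℝ) • A) x = x := by
  have : CompleteSpace E := FiniteDimensional.complete ℝ E
  rw [expAct_smul, zero_smul, NormedSpace.exp_zero, one_apply_eq_self]

theorem hasDerivAt_expAct (A : E →ₗ[ℝ] E) (x : E) (t : ℝ) :
    HasDerivAt (fun s : ℝ => expAct (s • A) x) (A (expAct (t • A) x)) t := by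
  have : CompleteSpace E := FiniteDimensional.complete ℝ E
  simp only [expAct_smul]
  exact (hasDerivAt_exp_smul_const' (LinearMap.toContinuousLinearMap A) t).clm_apply
    (hasDerivAt_const t x) |>.congr_deriv (by simp)

theorem contDiff_expAct (A : E →ₗ[ℝ] E) (x : E) :
    ContDiff ℝ ∞ (fun t : ℝ => expAct (t • A) x) := by
  have : CompleteSpace E := FiniteDimensional.complete ℝ E
  simp only [expAct_smul]
  exact (contDiff_exp_smul _).clm_apply contDiff_const

/-- Solutions of `p' = A p` are given by the exponential action. -/
theorem eq_expAct_of_hasDerivAt (A : E →ₗ[ℝ] E) {p : ℝ → E}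
    {J : Set ℝ} (hJ : IsOpen J) (hJ' : J.OrdConnected) (h0 : (0 : ℝ) ∈ J)
    (hp : ∀ t ∈ J, HasDerivAt p (A (p t)) t) {t : ℝ} (ht : t ∈ J) :
    p t = expAct (t • A) (p 0) := by
  have : CompleteSpace E := FiniteDimensional.complete ℝ E
  set L := LinearMap.toContinuousLinearMap A with hL
  have h := eq_of_hasDerivAt_zero (f := fun t => NormedSpace.exp ((-t) • L) (p t)) hJ hJ' h0
    (fun s hs => by
      -- The two formulas for the derivative of `e^{tL}` must agree, so `L` commutes with its
      -- exponential.
      have hcomm : NormedSpace.exp ((-s) • L) * L = L * NormedSpace.exp ((-s) • L) :=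
        (hasDerivAt_exp_smul_const L (-s)).unique (hasDerivAt_exp_smul_const' L (-s))
      refine ((hasDerivAt_exp_neg_smul L s).clm_apply (hp s hs)).congr_deriv ?_
      have := congrArg (fun T : E →L[ℝ] E => T (p s)) hcomm
      simp only [mul_apply_eq_comp] at this
      rw [neg_apply, mul_apply_eq_comp, ← this]
      exact neg_add_cancel _) ht
  simp only [neg_zero, zero_smul, NormedSpace.exp_zero, one_apply_eq_self] at h
  rw [expAct_smul, ← h, ← mul_apply_eq_comp, exp_smul_mul_exp_neg_smul,
    one_apply_eq_self]

/-- The partial sums of the exponential series stay in `W`, which is closed by finite dimension. -/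
theorem expAct_mem {A : E →ₗ[ℝ] E} {W : Submodule ℝ E} (hA : ∀ x ∈ W, A x ∈ W) {x : E}
    (hx : x ∈ W) : expAct A x ∈ W := by
  have : CompleteSpace E := FiniteDimensional.complete ℝ E
  set L := LinearMap.toContinuousLinearMap A with hL
  have hs := (NormedSpace.exp_series_hasSum_exp' (𝕂 := ℝ) L).mapL
    (ContinuousLinearMap.apply ℝ E x)
  refine W.closed_of_finiteDimensional.mem_of_tendsto hs (Filter.Eventually.of_forall fun s => ?_)
  have hk : ∀ k : ℕ, (L ^ k) x ∈ W := fun k => by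
    induction k with
    | zero => simpa using hx
    | succ k ih =>
      rw [pow_succ']
      exact hA _ ih
  exact W.sum_mem fun k _ => W.smul_mem _ (hk k)

end ExpAct

namespace MatrixLieGroup

variable {n : ℕ} {V : Type*} [NormedAddCommGroup V] [NormedSpace ℝ V]
  {G : Type*} [TopologicalSpace G] [ChartedSpace V G] [Group G] [LieGroup 𝓘(ℝ, V) ∞ G]
  (ι : MatrixLieGroup n V G)

/-! ### Curves in the group and one-parameter subgroups -/

/-- A continuous curve in the group is smooth if it is smooth as a curve of matrices. -/
theorem contMDiff_of_contDiff_curve [FiniteDimensional ℝ V] {γ : ℝ → G} (hγ : Continuous γ)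
    (hc : ContDiff ℝ ∞ (ι.curve γ)) : ContMDiff 𝓘(ℝ, ℝ) 𝓘(ℝ, V) ∞ γ := by
  have : CompleteSpace V := FiniteDimensional.complete ℝ V
  intro t₀
  set e := chartAt V (γ t₀) with he
  obtain ⟨P, hP⟩ := (ι.diff (γ t₀)).toLinearMap.exists_leftInverse_of_injective
    (LinearMap.ker_eq_bot.mpr (ι.diff_injective (γ t₀)))
  set Q : Mat n →L[ℝ] V := LinearMap.toContinuousLinearMap P
  -- Since `Q` inverts the differential at `γ t₀`, `h` has derivative the identity there, and the
  -- inverse function theorem recovers the coordinates of `γ` smoothly from its matrix. Continuity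
  -- of `γ` in the group keeps it in the chart; the topology of an immersed group can be finer than
  -- that of the matrices.
  set h : V → V := fun v => Q (ι.mat (e.symm v)) with hh
  have hsymm : ContMDiffAt 𝓘(ℝ, V) 𝓘(ℝ, V) ∞ e.symm (e (γ t₀)) :=
    (contMDiffOn_chart_symm (I := 𝓘(ℝ, V)) (x := γ t₀) (n := ∞)).contMDiffAt
      (e.open_target.mem_nhds (mem_chart_target V (γ t₀)))
  have hs : ContDiffAt ℝ ∞ h (e (γ t₀)) :=
    ((contMDiff_clm Q ι.contMDiff_mat).contMDiffAt.comp _ hsymm).contDiffAt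
  have hd : HasFDerivAt h ((ContinuousLinearEquiv.refl ℝ V : V ≃L[ℝ] V) : V →L[ℝ] V)
      (e (γ t₀)) := by
    have := Q.hasFDerivAt.comp _
      (hasFDerivAt_comp_chart (ι.contMDiff_mat.mdifferentiableAt_infty (γ t₀)))
    refine this.congr_fderiv ?_
    ext v
    exact LinearMap.congr_fun hP v
  have hn : (∞ : WithTop ℕ∞) ≠ 0 := by simp
  have hinv := (hs.hasStrictFDerivAt' hd hn).eventually_left_inverse
  have hsrc : ∀ᶠ t in nhds t₀, γ t ∈ e.source :=
    hγ.continuousAt.eventually (e.open_source.mem_nhds (mem_chart_source V (γ t₀)))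
  have hcont : ContinuousAt (fun t => e (γ t)) t₀ :=
    (e.continuousAt (mem_chart_source V (γ t₀))).comp hγ.continuousAt
  have heq : (fun t => hs.localInverse hd hn (Q (ι.curve γ t))) =ᶠ[nhds t₀] fun t => e (γ t) := by
    filter_upwards [hsrc, hcont.eventually hinv] with t ht ht'
    simp only [hh, e.left_inv ht] at ht'
    exact ht'
  have hval : Q (ι.curve γ t₀) = h (e (γ t₀)) := by
    simp only [hh, e.left_inv (mem_chart_source V (γ t₀)), curve]
  have hsm : ContDiffAt ℝ ∞ (fun t => e (γ t)) t₀ := by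
    refine ContDiffAt.congr_of_eventuallyEq ?_ heq.symm
    have h1 := hs.to_localInverse hd hn
    rw [← hval] at h1
    exact h1.comp t₀ (Q.contDiff.comp hc).contDiffAt
  refine contMDiffAt_iff_target.mpr ⟨hγ.continuousAt, ?_⟩
  exact hsm.contMDiffAt

theorem hasMFDerivAt_mul_left (g X : G) :
    HasMFDerivAt 𝓘(ℝ, V) 𝓘(ℝ, V) (fun x : G => g * x) X (mmap (fun x : G => g * x) X : V →L[ℝ] V) :=
  (mdifferentiableAt_mul_left g X).hasMFDerivAt

/-- The left-invariant vector field on the group with value `v` at the identity. -/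
noncomputable def leftInvField (v : V) (g : G) : V := mmap (fun x : G => g * x) 1 v

/-- Chain rule for `x ↦ g (h x)`. Left translations therefore carry integral curves to integral
curves. -/
theorem mmap_mul_left_leftInvField (g h : G) (v : V) :
    mmap (fun x => g * x) h (leftInvField v h) = leftInvField v (g * h) := by
  have h1 : HasMFDerivAt 𝓘(ℝ, V) 𝓘(ℝ, V) ((fun x : G => g * x) ∘ fun x => h * x) 1
      ((mmap (fun x => g * x) (h * 1)).comp (mmap (fun x => h * x) 1) : V →L[ℝ] V) :=
    HasMFDerivAt.comp 1 (hasMFDerivAt_mul_left g (h * 1)) (hasMFDerivAt_mul_left h 1)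
  have h2 := hasMFDerivAt_mul_left (V := V) (g * h) 1
  have h3 : ((fun x : G => g * x) ∘ fun x => h * x) = fun x => g * h * x :=
    funext fun x => (mul_assoc g h x).symm
  rw [h3] at h1
  have h4 := congrArg (fun L : V →L[ℝ] V => L v) (hasMFDerivAt_unique h1 h2)
  rw [mul_one] at h4
  exact h4

/-- Left-invariant vector fields are complete. -/
theorem exists_isMIntegralCurve_leftInvField [FiniteDimensional ℝ V] [T2Space G] (v : V) :
    ∃ φ : ℝ → G, φ 0 = 1 ∧
      IsMIntegralCurve (I := 𝓘(ℝ, V)) φ (fun g => leftInvField (V := V) v g) := by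
  have : CompleteSpace V := FiniteDimensional.complete ℝ V
  have : LieGroup 𝓘(ℝ, V) (minSmoothness ℝ 3) G := LieGroup.of_le (n := ∞) (by
    rw [minSmoothness_of_isRCLikeNormedField]
    exact WithTop.coe_le_coe.mpr le_top)
  have : IsManifold 𝓘(ℝ, V) 1 G := IsManifold.of_le (n := ∞) (by simp)
  have hv : ContMDiff 𝓘(ℝ, V) 𝓘(ℝ, V).tangent 1
      (fun g : G => (⟨g, leftInvField (V := V) v g⟩ : TangentBundle 𝓘(ℝ, V) G)) :=
    (contMDiff_mulInvariantVectorField (I := 𝓘(ℝ, V)) (G := G) v).of_le (by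
      rw [minSmoothness_of_isRCLikeNormedField]; norm_num)
  obtain ⟨γ, hγ0, hγ⟩ := exists_isMIntegralCurveAt_of_contMDiffAt_boundaryless (I := 𝓘(ℝ, V)) 0
    (hv.contMDiffAt (x := (1 : G)))
  obtain ⟨ε, hε, hγ⟩ := Metric.eventually_nhds_iff_ball.mp hγ
  -- Translates of the local curve through `1` exist for the same time `ε` at every point, and a
  -- uniform existence time gives completeness.
  refine exists_isMIntegralCurve_of_isMIntegralCurveOn hv hε (fun g => ?_) 1
  refine ⟨fun t => g * γ t, by simp [hγ0], fun t ht => ?_⟩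
  have ht' : t ∈ Metric.ball (0 : ℝ) ε := by rwa [Real.ball_eq_Ioo, zero_sub, zero_add]
  have h1 := (HasMFDerivAt.comp t (hasMFDerivAt_mul_left (V := V) g (γ t)) (hγ t ht'))
  have h2 : (mmap (V := V) (fun x => g * x) (γ t)).comp
      ((1 : ℝ →L[ℝ] ℝ).smulRight (leftInvField v (γ t)))
      = ((1 : ℝ →L[ℝ] ℝ).smulRight (leftInvField v (g * γ t)) : ℝ →L[ℝ] V) := by
    ext
    simp [← mmap_mul_left_leftInvField]
  have h3 : HasMFDerivAt 𝓘(ℝ, ℝ) 𝓘(ℝ, V) (fun t => g * γ t) t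
      ((1 : ℝ →L[ℝ] ℝ).smulRight (leftInvField v (g * γ t)) : ℝ →L[ℝ] V) := by
    rw [← h2]
    exact h1
  exact h3.hasMFDerivWithinAt

/-- Every element of the Lie algebra generates a smooth one-parameter subgroup. -/
theorem exists_curve_eq_exp [FiniteDimensional ℝ V] {a : Mat n} (ha : a ∈ ι.lieAlg) :
    ∃ φ : ℝ → G, ContMDiff 𝓘(ℝ, ℝ) 𝓘(ℝ, V) ∞ φ ∧
      ∀ t, ι.mat (φ t) = NormedSpace.exp (t • a) := by
  have : T2Space G := ι.t2Space
  obtain ⟨v, rfl⟩ := ι.exists_diff_eq ha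
  obtain ⟨φ, hφ0, hφ⟩ := exists_isMIntegralCurve_leftInvField (G := G) v
  -- Seen in matrices, the integral curve solves `c' = c a`, which identifies it with the
  -- exponential.
  have hd : ∀ t, HasDerivAt (ι.curve φ) (ι.curve φ t * ι.diff 1 v) t := fun t => by
    have h1 := hasDerivAt_comp_curve (ι.contMDiff_mat.mdifferentiableAt_infty (φ t))
      (v := leftInvField v (φ t)) (hφ t)
    have h2 := ι.mat_mul_diff (φ t) 1 v
    rw [mul_one] at h2
    rw [curve, h2]
    exact h1
  have hexp : ∀ t, ι.curve φ t = NormedSpace.exp (t • ι.diff 1 v) := fun t => by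
    have := eq_mul_exp_of_hasDerivAt isOpen_univ ordConnected_univ (mem_univ 0)
      (fun t _ => hd t) (mem_univ t)
    rwa [curve, curve, hφ0, mat_one, one_mul] at this
  refine ⟨φ, ι.contMDiff_of_contDiff_curve ?_ ?_, hexp⟩
  · exact continuous_iff_continuousAt.mpr fun t => (hφ t).continuousAt
  · rw [funext hexp]
    exact contDiff_exp_smul _

end MatrixLieGroup

/-! ### Conjugation by one-parameter groups -/

section Conjugation

variable {n : ℕ}

/-- Conjugation by the exponential of `t B`. -/
noncomputable def expConj (B : Mat n) (t : ℝ) (x : Mat n) : Mat n :=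
  NormedSpace.exp (t • B) * x * NormedSpace.exp ((-t) • B)

theorem expConj_zero (B x : Mat n) : expConj B 0 x = x := by
  simp [expConj]

theorem expConj_mul (B : Mat n) (t : ℝ) (x y : Mat n) :
    expConj B t (x * y) = expConj B t x * expConj B t y := by
  simp only [expConj]
  calc _ = NormedSpace.exp (t • B) * x * 1 * y * NormedSpace.exp ((-t) • B) := by
        simp only [mul_assoc, one_mul]
    _ = _ := by
        rw [← exp_neg_smul_mul_exp_smul B t]
        simp only [mul_assoc]

theorem expConj_add (B : Mat n) (t : ℝ) (x y : Mat n) :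
    expConj B t (x + y) = expConj B t x + expConj B t y := by
  simp only [expConj, mul_add, add_mul]

theorem expConj_sub (B : Mat n) (t : ℝ) (x y : Mat n) :
    expConj B t (x - y) = expConj B t x - expConj B t y := by
  simp only [expConj, mul_sub, sub_mul]

theorem expConj_smul (B : Mat n) (t r : ℝ) (x : Mat n) :
    expConj B t (r • x) = r • expConj B t x := by
  simp only [expConj, mul_smul_comm, smul_mul_assoc]

theorem expConj_lie (B : Mat n) (t : ℝ) (x y : Mat n) :
    expConj B t ⁅x, y⁆ = ⁅expConj B t x, expConj B t y⁆ := by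
  simp only [Ring.lie_def, expConj_sub, expConj_mul]

theorem exp_smul_mul_comm (B : Mat n) (t : ℝ) :
    NormedSpace.exp (t • B) * B = B * NormedSpace.exp (t • B) :=
  (hasDerivAt_exp_smul_const B t).unique (hasDerivAt_exp_smul_const' B t)

theorem expConj_self (B : Mat n) (t : ℝ) : expConj B t B = B := by
  rw [expConj, exp_smul_mul_comm, mul_assoc, exp_smul_mul_exp_neg_smul, mul_one]

theorem expConj_neg_expConj (B : Mat n) (t : ℝ) (x : Mat n) :
    expConj B (-t) (expConj B t x) = x := by
  simp only [expConj, neg_neg]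
  calc _ = (NormedSpace.exp ((-t) • B) * NormedSpace.exp (t • B)) * x *
        (NormedSpace.exp ((-t) • B) * NormedSpace.exp (t • B)) := by simp only [mul_assoc]
    _ = x := by rw [exp_neg_smul_mul_exp_smul, one_mul, mul_one]

theorem expConj_expConj_neg (B : Mat n) (t : ℝ) (x : Mat n) :
    expConj B t (expConj B (-t) x) = x := by
  have := expConj_neg_expConj B (-t) x
  rwa [neg_neg] at this

theorem hasDerivAt_expConj (B : Mat n) {d : ℝ → Mat n} {d' : Mat n} {t : ℝ}
    (hd : HasDerivAt d d' t) :
    HasDerivAt (fun s => expConj B s (d s)) (expConj B t (⁅B, d t⁆ + d')) t := by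
  refine (((hasDerivAt_exp_smul_const B t).mul hd).mul
    (hasDerivAt_exp_neg_smul B t)).congr_deriv ?_
  simp only [expConj, Ring.lie_def, Pi.mul_apply]
  noncomm_ring

theorem hasDerivAt_expConj_neg (B : Mat n) {d : ℝ → Mat n} {d' : Mat n} {t : ℝ}
    (hd : HasDerivAt d d' t) :
    HasDerivAt (fun s => expConj B (-s) (d s)) (expConj B (-t) (d' - ⁅B, d t⁆)) t := by
  have h := hasDerivAt_expConj (-B) hd
  have e : ∀ (s : ℝ) (x : Mat n), expConj (-B) s x = expConj B (-s) x := fun s x => by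
    simp only [expConj, smul_neg, neg_smul, neg_neg]
  simp only [e] at h
  convert! h using 2
  rw [neg_lie]
  abel

variable {𝔞 : LieSubalgebra ℝ (Mat n)}

theorem proj_lie_left (h𝔞 : IsTransposable 𝔞.toSubmodule) {A : Mat n}
    (hA : A ∈ 𝔞.toSubmodule) (x : Mat n) :
    proj 𝔞.toSubmodule ⁅A, x⁆ = ⁅A, proj 𝔞.toSubmodule x⁆ := by
  rw [← lie_skew, map_neg, proj_lie h𝔞 x hA, lie_skew]

/-- The infinitesimal commutation `proj_lie` is integrated: conjugating the projection by the flow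
of `ad B` gives a curve with zero derivative. -/
theorem proj_expConj (h𝔞 : IsTransposable 𝔞.toSubmodule) {B : Mat n}
    (hB : B ∈ 𝔞.toSubmodule) (t : ℝ) (x : Mat n) :
    proj 𝔞.toSubmodule (expConj B t x) = expConj B t (proj 𝔞.toSubmodule x) := by
  have hd : ∀ s ∈ (univ : Set ℝ), HasDerivAt
      (fun s => expConj B (-s) (proj 𝔞.toSubmodule (expConj B s x))) 0 s := fun s _ => by
    have h1 := hasDerivAt_expConj B (hasDerivAt_const s x)
    have h2 := (LinearMap.toContinuousLinearMap
      (proj 𝔞.toSubmodule)).hasFDerivAt.comp_hasDerivAt s h1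
    have h3 := hasDerivAt_expConj_neg B h2
    refine h3.congr_deriv ?_
    have : expConj B s (⁅B, x⁆ + 0) = ⁅B, expConj B s x⁆ := by
      rw [add_zero, expConj_lie, expConj_self]
    rw [this]
    change expConj B (-s) (proj 𝔞.toSubmodule ⁅B, expConj B s x⁆
      - ⁅B, proj 𝔞.toSubmodule (expConj B s x)⁆) = 0
    rw [proj_lie_left h𝔞 hB, sub_self]
    simp [expConj]
  have h := eq_of_hasDerivAt_zero isOpen_univ ordConnected_univ (mem_univ 0) hd (mem_univ t)
  simp only [neg_zero, expConj_zero] at h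
  rw [← h, expConj_expConj_neg]

/-- Conjugation preserves brackets and, for `B ∈ 𝔞`, commutes with the projection; `L` is built from
these alone. -/
theorem expConj_opL (h𝔞 : IsTransposable 𝔞.toSubmodule) {B : Mat n}
    (hB : B ∈ 𝔞.toSubmodule) (β t : ℝ) (x y : Mat n) :
    expConj B t (opL β 𝔞.toSubmodule x y)
      = opL β 𝔞.toSubmodule (expConj B t x) (expConj B t y) := by
  simp only [opL, expConj_smul, expConj_add, expConj_lie, proj_expConj h𝔞 hB]

theorem opL_self (β : ℝ) (W : Submodule ℝ (Mat n)) (w : Mat n) :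
    opL β W w w = (1 + β) • ⁅proj W w, w⁆ := by
  rw [opL, lie_self]
  module

/-- Solutions of the reduced geodesic equation `w' = -L(w, w)` are conjugates of the
initial value. -/
theorem eq_expConj_of_hasDerivAt (h𝔞 : IsTransposable 𝔞.toSubmodule) (β : ℝ) {w : ℝ → Mat n}
    {J : Set ℝ} (hJ : IsOpen J) (hJ' : J.OrdConnected) (h0 : (0 : ℝ) ∈ J)
    (hw : ∀ t ∈ J, HasDerivAt w (-opL β 𝔞.toSubmodule (w t) (w t)) t) {t : ℝ} (ht : t ∈ J) :
    w t = expConj ((1 + β) • proj 𝔞.toSubmodule (w 0)) (-t) (w 0) := by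
  -- Conservation law: the 𝔞-part of `L(w, w)` is `(1 + β)[w_𝔞, w_𝔞] = 0`.
  have hp : ∀ t ∈ J, proj 𝔞.toSubmodule (w t) = proj 𝔞.toSubmodule (w 0) := fun t ht => by
    refine eq_of_hasDerivAt_zero (f := fun t => proj 𝔞.toSubmodule (w t)) hJ hJ' h0
      (fun s hs => ?_) ht
    refine ((LinearMap.toContinuousLinearMap
      (proj 𝔞.toSubmodule)).hasFDerivAt.comp_hasDerivAt s (hw s hs)).congr_deriv ?_
    change proj 𝔞.toSubmodule (-opL β 𝔞.toSubmodule (w s) (w s)) = 0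
    rw [opL_self, map_neg, map_smul, proj_lie_left h𝔞 (proj_mem _ _), lie_self, smul_zero, neg_zero]
  set B := (1 + β) • proj 𝔞.toSubmodule (w 0) with hB
  -- With `w_𝔞` constant the equation becomes the linear one `w' = -[B, w]`, which conjugation by
  -- `e^{tB}` undoes.
  have h := eq_of_hasDerivAt_zero (f := fun t => expConj B t (w t)) hJ hJ' h0 (fun s hs => by
    refine (hasDerivAt_expConj B (hw s hs)).congr_deriv ?_
    rw [opL_self, hp s hs, ← smul_lie, ← hB, add_neg_cancel]
    simp [expConj]) ht
  simp only [expConj_zero] at h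
  rw [← h, expConj_neg_expConj]

theorem hasDerivAt_expConj_opL (h𝔞 : IsTransposable 𝔞.toSubmodule) (β : ℝ) (a : Mat n) (t : ℝ) :
    HasDerivAt (fun s => expConj ((1 + β) • proj 𝔞.toSubmodule a) (-s) a)
      (-opL β 𝔞.toSubmodule (expConj ((1 + β) • proj 𝔞.toSubmodule a) (-t) a)
        (expConj ((1 + β) • proj 𝔞.toSubmodule a) (-t) a)) t := by
  refine (hasDerivAt_expConj_neg _ (hasDerivAt_const t a)).congr_deriv ?_
  rw [← expConj_opL h𝔞 (𝔞.toSubmodule.smul_mem _ (proj_mem _ _)), opL_self, smul_lie]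
  simp [expConj]

/-- Solutions of `c' = c w`, where `w` is obtained by conjugating `a` with `exp (-t B)`. -/
theorem eq_of_hasDerivAt_mul_expConj {a B : Mat n} {c : ℝ → Mat n}
    {J : Set ℝ} (hJ : IsOpen J) (hJ' : J.OrdConnected) (h0 : (0 : ℝ) ∈ J)
    (hc : ∀ t ∈ J, HasDerivAt c (c t * expConj B (-t) a) t) {t : ℝ} (ht : t ∈ J) :
    c t = c 0 * NormedSpace.exp (t • (-B + a)) * NormedSpace.exp (t • B) := by
  -- Multiplying on the right by `e^{-tB}` removes the time dependence: the new curve satisfies an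
  -- equation with constant coefficient `a - B`.
  have h := eq_mul_exp_of_hasDerivAt (c := fun t => c t * NormedSpace.exp ((-t) • B))
    (a := -B + a) hJ hJ' h0 (fun s hs => by
      refine ((hc s hs).mul (hasDerivAt_exp_neg_smul B s)).congr_deriv ?_
      simp only [expConj, neg_neg]
      have h1 : c s * (NormedSpace.exp ((-s) • B) * a * NormedSpace.exp (s • B))
          * NormedSpace.exp ((-s) • B) = c s * NormedSpace.exp ((-s) • B) * a := by
        rw [mul_assoc, mul_assoc (_ * a), exp_smul_mul_exp_neg_smul, mul_one, mul_assoc]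
      rw [h1, ← exp_smul_mul_comm]
      noncomm_ring) ht
  simp only [neg_zero, zero_smul, NormedSpace.exp_zero, mul_one] at h
  rw [← h, mul_assoc, exp_neg_smul_mul_exp_smul, mul_one]

theorem hasDerivAt_mul_exp_mul_exp (x a B : Mat n) (t : ℝ) :
    HasDerivAt (fun s : ℝ => x * NormedSpace.exp (s • (-B + a)) * NormedSpace.exp (s • B))
      (x * NormedSpace.exp (t • (-B + a)) * NormedSpace.exp (t • B) * expConj B (-t) a) t := by
  refine (((hasDerivAt_exp_smul_const (-B + a) t).const_mul x).mul
    (hasDerivAt_exp_smul_const' B t)).congr_deriv ?_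
  have h1 : NormedSpace.exp (t • B) * (NormedSpace.exp ((-t) • B) * a * NormedSpace.exp (t • B))
      = a * NormedSpace.exp (t • B) := by
    rw [← mul_assoc, ← mul_assoc, exp_smul_mul_exp_neg_smul, one_mul]
  rw [expConj, neg_neg, mul_assoc _ (NormedSpace.exp (t • B)), h1]
  noncomm_ring

end Conjugation

namespace MatrixLieGroup

variable {n : ℕ} {V : Type*} [NormedAddCommGroup V] [NormedSpace ℝ V]
  {G : Type*} [TopologicalSpace G] [ChartedSpace V G] [Group G] [LieGroup 𝓘(ℝ, V) ∞ G]
  {ι : MatrixLieGroup n V G}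

/-! ### Covariant derivatives along curves -/

/-- The Christoffel function is determined by the metric on tangent vectors. -/
theorem IsChristoffel.eq {m : G → LinearMap.BilinForm ℝ (Mat n)}
    (hm : ι.IsPseudoRiemannianMetric m) {Γ Γ' : G → Mat n → Mat n → Mat n}
    (h : ι.IsChristoffel m Γ) (h' : ι.IsChristoffel m Γ') {X : G} {ξ η : Mat n}
    (hξ : ξ ∈ ι.tangentAt X) (hη : η ∈ ι.tangentAt X) : Γ X ξ η = Γ' X ξ η := by
  obtain ⟨Y, hY, rfl⟩ := ι.exists_isVectorField_apply_eq hξ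
  obtain ⟨Z, hZ, rfl⟩ := ι.exists_isVectorField_apply_eq hη
  exact add_left_cancel (congrFun (IsLeviCivita.unique hm h h' hY hZ) X)

variable (ι)

theorem contDiffOn_curve {γ : ℝ → G} {J : Set ℝ} (hγ : ContMDiffOn 𝓘(ℝ, ℝ) 𝓘(ℝ, V) ∞ γ J) :
    ContDiffOn ℝ ∞ (ι.curve γ) J :=
  (ι.contMDiff_mat.comp_contMDiffOn hγ).contDiffOn

theorem contDiffOn_curve_inv {γ : ℝ → G} {J : Set ℝ}
    (hγ : ContMDiffOn 𝓘(ℝ, ℝ) 𝓘(ℝ, V) ∞ γ J) :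
    ContDiffOn ℝ ∞ (fun t => (ι.curve γ t)⁻¹) J :=
  (ι.contMDiff_mat_inv.comp_contMDiffOn hγ).contDiffOn

theorem hasDerivAt_curve {γ : ℝ → G} {J : Set ℝ} (hJ : IsOpen J)
    (hγ : ContMDiffOn 𝓘(ℝ, ℝ) 𝓘(ℝ, V) ∞ γ J) {t : ℝ} (ht : t ∈ J) :
    HasDerivAt (ι.curve γ) (deriv (ι.curve γ) t) t :=
  (((ι.contDiffOn_curve hγ).contDiffAt (hJ.mem_nhds ht)).differentiableAt (by simp)).hasDerivAt

theorem deriv_curve_mem {γ : ℝ → G} {J : Set ℝ} (hJ : IsOpen J)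
    (hγ : ContMDiffOn 𝓘(ℝ, ℝ) 𝓘(ℝ, V) ∞ γ J) {t : ℝ} (ht : t ∈ J) :
    deriv (ι.curve γ) t ∈ ι.tangentAt (γ t) := by
  have h1 : MDifferentiableAt 𝓘(ℝ, ℝ) 𝓘(ℝ, V) γ t :=
    (hγ.contMDiffAt (hJ.mem_nhds ht)).mdifferentiableAt (by simp)
  set L : ℝ →L[ℝ] V := mfderiv 𝓘(ℝ, ℝ) 𝓘(ℝ, V) γ t with hL
  have h2 : L = (1 : ℝ →L[ℝ] ℝ).smulRight (L 1) := by ext; simp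
  have h3 : HasMFDerivAt 𝓘(ℝ, ℝ) 𝓘(ℝ, V) γ t ((1 : ℝ →L[ℝ] ℝ).smulRight (L 1) : ℝ →L[ℝ] V) := by
    rw [← h2]
    exact h1.hasMFDerivAt
  have h4 := hasDerivAt_comp_curve (ι.contMDiff_mat.mdifferentiableAt_infty (γ t)) h3
  have h5 : deriv (ι.curve γ) t = mder ι.mat (γ t) (L 1) := h4.deriv
  rw [h5]
  exact ι.diff_mem _ _

/-- The covariant derivative along a curve in the left trivialization. -/
theorem covDeriv_along_curve (β : ℝ) (W : Submodule ℝ (Mat n)) {γ : ℝ → G} {w d' : Mat n}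
    {d Δ : ℝ → Mat n} {t : ℝ} (hc : HasDerivAt (ι.curve γ) (ι.curve γ t * w) t)
    (hd : HasDerivAt d d' t) (hΔ : Δ =ᶠ[nhds t] fun s => ι.curve γ s * d s) :
    deriv Δ t + ι.christoffel β W (γ t) (deriv (ι.curve γ) t) (Δ t)
      = ι.curve γ t * (d' + opL β W w (d t)) := by
  have h : deriv (fun s => ι.curve γ s * d s) t = _ := (hc.mul hd).deriv
  rw [hΔ.deriv_eq, hΔ.eq_of_nhds, hc.deriv, h, curve, christoffel_mat_mul, mul_add, mul_assoc]
  abel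

theorem hasDerivAt_curve_of_eq {γ : ℝ → G} {X : G} {a B : Mat n} (hγ : ∀ t, ι.curve γ t = ι.mat X
      * NormedSpace.exp (t • (-B + a)) * NormedSpace.exp (t • B)) (t : ℝ) :
    HasDerivAt (ι.curve γ) (ι.curve γ t * expConj B (-t) a) t := by
  rw [funext hγ]
  exact hasDerivAt_mul_exp_mul_exp _ _ _ t

/-! ### Closed form of the geodesics -/

variable [FiniteDimensional ℝ V] {𝔞 : LieSubalgebra ℝ (Mat n)} {β₀ β₁ β : ℝ}

theorem curve_eq_of_isGeodesicOn
    (hm : ι.IsPseudoRiemannianMetric (ι.leftInvMetric (betaForm β₀ β₁ 𝔞.toSubmodule)))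
    (h𝔞𝔤 : 𝔞.toSubmodule ≤ ι.lieAlg) (h𝔞 : IsTransposable 𝔞.toSubmodule) (hβ : β₀ * β = β₁)
    {γ : ℝ → G} {J : Set ℝ} (hJ : IsOpen J) (hJ' : J.OrdConnected) (h0 : (0 : ℝ) ∈ J)
    (hγ : ι.IsGeodesicOn (ι.leftInvMetric (betaForm β₀ β₁ 𝔞.toSubmodule)) γ J) {a : Mat n}
    (ha : a = (ι.mat (γ 0))⁻¹ * deriv (ι.curve γ) 0) {t : ℝ} (ht : t ∈ J) :
    ι.curve γ t = ι.mat (γ 0) * NormedSpace.exp (t • (-((1 + β) • proj 𝔞.toSubmodule a) + a))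
      * NormedSpace.exp (t • (1 + β) • proj 𝔞.toSubmodule a) := by
  obtain ⟨hs, Γ, hΓ, hode⟩ := hγ
  set c := ι.curve γ with hc
  set w : ℝ → Mat n := fun t => (c t)⁻¹ * deriv c t with hw
  have hcw : ∀ t, c t * w t = deriv c t := fun t => ι.mat_mul_inv_cancel_left (γ t) _
  have hcd : ∀ t ∈ J, HasDerivAt c (c t * w t) t := fun t ht => by
    rw [hcw]
    exact ι.hasDerivAt_curve hJ hs ht
  have hwd : ∀ t ∈ J, DifferentiableAt ℝ w t := fun t ht => by
    have h1 := (ι.contDiffOn_curve_inv hs).mul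
      ((ι.contDiffOn_curve hs).deriv_of_isOpen hJ (m := ∞) (by simp))
    exact (h1.contDiffAt (hJ.mem_nhds ht)).differentiableAt (by simp)
  have hwode : ∀ t ∈ J, HasDerivAt w (-opL β 𝔞.toSubmodule (w t) (w t)) t := fun t ht => by
    have h1 := ι.covDeriv_along_curve β 𝔞.toSubmodule (Δ := deriv c) (hcd t ht)
      (hwd t ht).hasDerivAt (Filter.Eventually.of_forall fun s => (hcw s).symm)
    have hξ := ι.deriv_curve_mem hJ hs ht
    -- The geodesic equation holds for some Christoffel function; on tangent vectors it coincides
    -- with the explicit one.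
    rw [IsChristoffel.eq hm (ι.isLeviCivita_christoffel h𝔞𝔤 h𝔞 hβ) hΓ hξ hξ, hode t ht] at h1
    have h2 : deriv w t + opL β 𝔞.toSubmodule (w t) (w t) = 0 := by
      rw [← ι.inv_mul_mat_cancel_left (γ t) (_ + _)]
      exact (congrArg ((ι.mat (γ t))⁻¹ * ·) h1.symm).trans (mul_zero _)
    rw [← eq_neg_of_add_eq_zero_left h2]
    exact (hwd t ht).hasDerivAt
  have hw0 : w 0 = a := ha.symm
  have hwt : ∀ t ∈ J, HasDerivAt c
      (c t * expConj ((1 + β) • proj 𝔞.toSubmodule a) (-t) a) t := fun t ht => by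
    have := eq_expConj_of_hasDerivAt h𝔞 β hJ hJ' h0 hwode ht
    rw [hw0] at this
    rw [← this]
    exact hcd t ht
  exact eq_of_hasDerivAt_mul_expConj hJ hJ' h0 hwt ht

/-- Both exponents lie in the Lie algebra, so the product is one of one-parameter subgroups and
lifts to a smooth curve in the group. -/
theorem exists_curve_eq (X : G) (h𝔞𝔤 : 𝔞.toSubmodule ≤ ι.lieAlg) (β : ℝ) {a : Mat n}
    (ha : a ∈ ι.lieAlg) :
    ∃ γ : ℝ → G, ContMDiff 𝓘(ℝ, ℝ) 𝓘(ℝ, V) ∞ γ ∧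
      (∀ t, ι.curve γ t = ι.mat X
        * NormedSpace.exp (t • (-((1 + β) • proj 𝔞.toSubmodule a) + a))
        * NormedSpace.exp (t • (1 + β) • proj 𝔞.toSubmodule a)) := by
  have hB : (1 + β) • proj 𝔞.toSubmodule a ∈ ι.lieAlg :=
    ι.lieAlg.smul_mem _ (h𝔞𝔤 (proj_mem _ _))
  obtain ⟨φ₁, h₁, e₁⟩ := ι.exists_curve_eq_exp
    (ι.lieAlg.add_mem (ι.lieAlg.neg_mem hB) ha)
  obtain ⟨φ₂, h₂, e₂⟩ := ι.exists_curve_eq_exp hB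
  exact ⟨fun t => X * φ₁ t * φ₂ t, (contMDiff_const.mul h₁).mul h₂, fun t => by
    rw [curve, mat_mul, mat_mul, e₁, e₂]⟩

/-- The exponential of `t B` is the matrix of a group element, and the adjoint action preserves the
Lie algebra. -/
theorem expConj_mem_lieAlg {B : Mat n} (hB : B ∈ ι.lieAlg) (t : ℝ) {x : Mat n}
    (hx : x ∈ ι.lieAlg) : expConj B t x ∈ ι.lieAlg := by
  obtain ⟨φ, -, e⟩ := ι.exists_curve_eq_exp hB
  have h1 := ι.conj_mem_lieAlg (φ t) hx
  have h2 : (ι.mat (φ t))⁻¹ = NormedSpace.exp ((-t) • B) :=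
    Matrix.inv_eq_right_inv (by rw [e, exp_smul_mul_exp_neg_smul])
  rwa [h2, e] at h1

/-! ### The geodesic equation and parallel transport along the explicit curves -/

section AlongGeodesic

variable {γ : ℝ → G} {X : G} {a : Mat n}

theorem isGeodesicOn_of_curve_eq (h𝔞𝔤 : 𝔞.toSubmodule ≤ ι.lieAlg)
    (h𝔞 : IsTransposable 𝔞.toSubmodule) (hβ : β₀ * β = β₁)
    (hs : ContMDiff 𝓘(ℝ, ℝ) 𝓘(ℝ, V) ∞ γ)
    (hγ : ∀ t, ι.curve γ t = ι.mat X
        * NormedSpace.exp (t • (-((1 + β) • proj 𝔞.toSubmodule a) + a))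
        * NormedSpace.exp (t • (1 + β) • proj 𝔞.toSubmodule a)) :
    ι.IsGeodesicOn (ι.leftInvMetric (betaForm β₀ β₁ 𝔞.toSubmodule)) γ univ := by
  refine ⟨hs.contMDiffOn, _, ι.isLeviCivita_christoffel h𝔞𝔤 h𝔞 hβ, fun t _ => ?_⟩
  have hd := ι.hasDerivAt_curve_of_eq hγ
  rw [ι.covDeriv_along_curve β 𝔞.toSubmodule (hd t) (hasDerivAt_expConj_opL h𝔞 β a t)
    (Filter.Eventually.of_forall fun s => (hd s).deriv), neg_add_cancel, mul_zero]

theorem eq_of_isParallelOn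
    (hm : ι.IsPseudoRiemannianMetric (ι.leftInvMetric (betaForm β₀ β₁ 𝔞.toSubmodule)))
    (h𝔞𝔤 : 𝔞.toSubmodule ≤ ι.lieAlg) (h𝔞 : IsTransposable 𝔞.toSubmodule) (hβ : β₀ * β = β₁)
    (hs : ContMDiff 𝓘(ℝ, ℝ) 𝓘(ℝ, V) ∞ γ)
    (hγ : ∀ t, ι.curve γ t = ι.mat X
        * NormedSpace.exp (t • (-((1 + β) • proj 𝔞.toSubmodule a) + a))
        * NormedSpace.exp (t • (1 + β) • proj 𝔞.toSubmodule a))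
    {J : Set ℝ} (hJ : IsOpen J) (hJ' : J.OrdConnected) (h0 : (0 : ℝ) ∈ J) {Δ : ℝ → Mat n}
    (hΔ : ι.IsParallelOn (ι.leftInvMetric (betaForm β₀ β₁ 𝔞.toSubmodule)) γ Δ J)
    {t : ℝ} (ht : t ∈ J) :
    Δ t = ι.mat X * NormedSpace.exp (t • (-((1 + β) • proj 𝔞.toSubmodule a) + a))
      * expAct (t • opP β 𝔞.toSubmodule a) ((ι.mat X)⁻¹ * Δ 0)
      * NormedSpace.exp (t • (1 + β) • proj 𝔞.toSubmodule a) := by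
  obtain ⟨hΔs, hΔm, Γ, hΓ, hode⟩ := hΔ
  have hd := ι.hasDerivAt_curve_of_eq hγ
  set B := (1 + β) • proj 𝔞.toSubmodule a with hB
  have hB𝔞 : B ∈ 𝔞.toSubmodule := 𝔞.toSubmodule.smul_mem _ (proj_mem _ _)
  set d : ℝ → Mat n := fun t => (ι.curve γ t)⁻¹ * Δ t with hdd
  have hcd : ∀ t, ι.curve γ t * d t = Δ t := fun t => ι.mat_mul_inv_cancel_left (γ t) _
  have hdiff : ∀ t ∈ J, HasDerivAt d (deriv d t) t := fun t ht =>
    (((((ι.contDiffOn_curve_inv hs.contMDiffOn).mono (subset_univ J)).mul hΔs).contDiffAt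
      (hJ.mem_nhds ht)).differentiableAt (by simp)).hasDerivAt
  have hdode : ∀ t ∈ J, deriv d t + opL β 𝔞.toSubmodule (expConj B (-t) a) (d t) = 0 :=
    fun t ht => by
    have h1 := ι.covDeriv_along_curve β 𝔞.toSubmodule (Δ := Δ) (hd t) (hdiff t ht)
      (Filter.Eventually.of_forall fun s => (hcd s).symm)
    rw [IsChristoffel.eq hm (ι.isLeviCivita_christoffel h𝔞𝔤 h𝔞 hβ) hΓ
      (ι.deriv_curve_mem isOpen_univ hs.contMDiffOn (mem_univ t)) (hΔm t ht), hode t ht] at h1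
    rw [← ι.inv_mul_mat_cancel_left (γ t) (_ + _)]
    exact (congrArg ((ι.mat (γ t))⁻¹ * ·) h1.symm).trans (mul_zero _)
  -- In the frame rotated by `e^{tB}` the velocity `w` becomes the constant `a`, so the equation for
  -- `d` becomes `p' = [B, p] - L(a, p) = P_a p`.
  have hp := eq_expAct_of_hasDerivAt (opP β 𝔞.toSubmodule a) (p := fun t => expConj B t (d t))
    hJ hJ' h0 (fun s hs => by
      refine (hasDerivAt_expConj B (hdiff s hs)).congr_deriv ?_
      rw [eq_neg_of_add_eq_zero_left (hdode s hs), expConj_add, opP_eq, ← smul_lie, ← hB,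
        ← neg_one_smul ℝ (opL _ _ _ _), expConj_smul, expConj_opL h𝔞 hB𝔞, expConj_expConj_neg,
        expConj_lie, expConj_self]
      module) ht
  have h00 : ι.curve γ 0 = ι.mat X := by simp [hγ]
  simp only [expConj_zero] at hp
  have hd0 : d 0 = (ι.mat X)⁻¹ * Δ 0 := by simp only [hdd, h00]
  rw [hd0] at hp
  rw [← hcd t, hγ t, ← hp, expConj]
  have h1 := exp_neg_smul_mul_exp_smul B t
  simp only [mul_assoc]
  rw [h1, mul_one]

theorem exists_isParallelOn (h𝔞𝔤 : 𝔞.toSubmodule ≤ ι.lieAlg)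
    (h𝔞 : IsTransposable 𝔞.toSubmodule) (hβ : β₀ * β = β₁) (ha : a ∈ ι.lieAlg)
    (hγ : ∀ t, ι.curve γ t = ι.mat X
        * NormedSpace.exp (t • (-((1 + β) • proj 𝔞.toSubmodule a) + a))
        * NormedSpace.exp (t • (1 + β) • proj 𝔞.toSubmodule a))
    {x : Mat n} (hx : x ∈ ι.lieAlg) :
    ι.IsParallelOn (ι.leftInvMetric (betaForm β₀ β₁ 𝔞.toSubmodule)) γ
      (fun t => ι.mat X * NormedSpace.exp (t • (-((1 + β) • proj 𝔞.toSubmodule a) + a))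
        * expAct (t • opP β 𝔞.toSubmodule a) x
        * NormedSpace.exp (t • (1 + β) • proj 𝔞.toSubmodule a)) univ := by
  have hd := ι.hasDerivAt_curve_of_eq hγ
  set B := (1 + β) • proj 𝔞.toSubmodule a with hB
  have hB𝔞 : B ∈ 𝔞.toSubmodule := 𝔞.toSubmodule.smul_mem _ (proj_mem _ _)
  set p : ℝ → Mat n := fun t => expAct (t • opP β 𝔞.toSubmodule a) x with hp
  have hP : ∀ y ∈ ι.lieAlg, opP β 𝔞.toSubmodule a y ∈ ι.lieAlg := fun y hy => by
    rw [opP_eq]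
    exact ι.lieAlg.sub_mem (ι.lieAlg.smul_mem _ (ι.lie_mem_lieAlg (h𝔞𝔤 (proj_mem _ _)) hy))
      (ι.opL_mem β h𝔞𝔤 ha hy)
  have hpm : ∀ t, p t ∈ ι.lieAlg := fun t =>
    expAct_mem (fun y hy => ι.lieAlg.smul_mem _ (hP y hy)) hx
  -- The two factors `e^{tB}` and `e^{-tB}` cancel, so the claimed field is `γ` times an element
  -- conjugate to `p`. This form yields both tangency and the transport equation.
  have hcd : ∀ t, ι.mat X * NormedSpace.exp (t • (-B + a)) * p t * NormedSpace.exp (t • B)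
      = ι.curve γ t * expConj B (-t) (p t) := fun t => by
    rw [hγ t, expConj, neg_neg]
    have h1 : NormedSpace.exp (t • B) * (NormedSpace.exp ((-t) • B) * p t * NormedSpace.exp (t • B))
        = p t * NormedSpace.exp (t • B) := by
      rw [← mul_assoc, ← mul_assoc, exp_smul_mul_exp_neg_smul, one_mul]
    rw [mul_assoc _ (NormedSpace.exp (t • B)), h1, mul_assoc _ (p t)]
  refine ⟨?_, fun s _ => ?_, _, ι.isLeviCivita_christoffel h𝔞𝔤 h𝔞 hβ, fun s _ => ?_⟩
  · exact (((contDiff_const.mul (contDiff_exp_smul _)).mul (contDiff_expAct _ _)).mul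
      (contDiff_exp_smul _)).contDiffOn
  · have h := ι.mat_mul_mem_tangentAt (γ s) (ι.expConj_mem_lieAlg (h𝔞𝔤 hB𝔞) (-s) (hpm s))
    rw [show ι.mat (γ s) * expConj B (-s) (p s) = _ from (hcd s).symm] at h
    exact h
  · rw [ι.covDeriv_along_curve β 𝔞.toSubmodule (hd s)
      (hasDerivAt_expConj_neg B (hasDerivAt_expAct (opP β 𝔞.toSubmodule a) x s))
      (Filter.Eventually.of_forall hcd)]
    rw [← expConj_opL h𝔞 hB𝔞, ← expConj_add, opP_eq, ← smul_lie, ← hB]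
    have : ⁅B, expAct (s • opP β 𝔞.toSubmodule a) x⁆
        - opL β 𝔞.toSubmodule a (expAct (s • opP β 𝔞.toSubmodule a) x)
        - ⁅B, expAct (s • opP β 𝔞.toSubmodule a) x⁆ + opL β 𝔞.toSubmodule a (p s) = 0 := by
      simp only [hp]
      abel
    rw [this]
    simp [expConj]

end AlongGeodesic

end MatrixLieGroup

end MatrixTransport

/-! ### Assembly of the statements -/

theorem mainTheorem2 {n : ℕ} {V : Type*} [NormedAddCommGroup V] [NormedSpace ℝ V]
    [FiniteDimensional ℝ V] {G : Type*} [TopologicalSpace G] [ChartedSpace V G] [Group G]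
    [LieGroup 𝓘(ℝ, V) ∞ G] [ConnectedSpace G]
    (ι : MatrixLieGroup n V G) (h𝔤 : IsTransposable ι.lieAlg)
    (𝔞 : LieSubalgebra ℝ (Mat n)) (h𝔞𝔤 : 𝔞.toSubmodule ≤ ι.lieAlg)
    (h𝔞 : IsTransposable 𝔞.toSubmodule)
    (β₀ β₁ β : ℝ) (hβ₀₁ : β₀ * β₁ ≠ 0) (hβ : β = β₁ / β₀) :
    -- the form is symmetric and nondegenerate on the Lie algebra
    ((betaForm β₀ β₁ 𝔞.toSubmodule).restrict ι.lieAlg).IsSymm ∧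
    ((betaForm β₀ β₁ 𝔞.toSubmodule).restrict ι.lieAlg).Nondegenerate ∧
    -- it defines a left-invariant pseudo-Riemannian metric
    ι.IsPseudoRiemannianMetric (ι.leftInvMetric (betaForm β₀ β₁ 𝔞.toSubmodule)) ∧
    ι.IsLeftInvariant (ι.leftInvMetric (betaForm β₀ β₁ 𝔞.toSubmodule)) ∧
    -- the Levi-Civita connection
    (∀ nab : (G → Mat n) → (G → Mat n) → G → Mat n,
      ι.IsLeviCivita (ι.leftInvMetric (betaForm β₀ β₁ 𝔞.toSubmodule)) nab ↔
        ∀ Y Z, ι.IsVectorField Y → ι.IsVectorField Z →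
          nab Y Z = ι.covDeriv (ι.christoffel β 𝔞.toSubmodule) Y Z) ∧
    -- the last term of the Christoffel function
    (∀ a ∈ ι.lieAlg, ∀ b ∈ ι.lieAlg,
      ⁅proj 𝔞.toSubmodule a, b⁆ + ⁅proj 𝔞.toSubmodule b, a⁆
        ∈ bowtie ι.lieAlg 𝔞.toSubmodule) ∧
    (∀ X, ∀ ξ ∈ ι.tangentAt X, ∀ η ∈ ι.tangentAt X,
      ∃ w ∈ bowtie ι.lieAlg 𝔞.toSubmodule,
        ι.christoffelTail β 𝔞.toSubmodule X ξ η = ι.mat X * w) ∧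
    -- geodesics and parallel transport along them
    (∀ X, ∀ ξ ∈ ι.tangentAt X, ∀ a, a = (ι.mat X)⁻¹ * ξ →
      ∃ γ : ℝ → G,
        ι.IsGeodesicOn (ι.leftInvMetric (betaForm β₀ β₁ 𝔞.toSubmodule)) γ univ ∧
        γ 0 = X ∧ deriv (ι.curve γ) 0 = ξ ∧
        (∀ t : ℝ, ι.curve γ t =
          ι.mat X * NormedSpace.exp (t • (-((1 + β) • proj 𝔞.toSubmodule a) + a))
            * NormedSpace.exp ((t * (1 + β)) • proj 𝔞.toSubmodule a)) ∧
        (∀ J : Set ℝ, IsOpen J → J.OrdConnected → (0 : ℝ) ∈ J → ∀ γ' : ℝ → G,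
          ι.IsGeodesicOn (ι.leftInvMetric (betaForm β₀ β₁ 𝔞.toSubmodule)) γ' J →
          γ' 0 = X → deriv (ι.curve γ') 0 = ξ → EqOn γ' γ J) ∧
        (∀ η ∈ ι.tangentAt X, ∀ (t : ℝ) (ζ : Mat n),
          ι.IsParallelTransport (ι.leftInvMetric (betaForm β₀ β₁ 𝔞.toSubmodule)) γ t η ζ ↔
            ζ = ι.mat X * NormedSpace.exp (t • (-((1 + β) • proj 𝔞.toSubmodule a) + a))
              * expAct (t • opP β 𝔞.toSubmodule a) ((ι.mat X)⁻¹ * η)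
              * NormedSpace.exp ((t * (1 + β)) • proj 𝔞.toSubmodule a))) ∧
    -- the operator `P_a` on the Lie algebra and its Frobenius adjoint
    (∀ a ∈ ι.lieAlg, ∀ b ∈ ι.lieAlg,
      opP β 𝔞.toSubmodule a b ∈ ι.lieAlg ∧ opPAdj β 𝔞.toSubmodule a b ∈ ι.lieAlg) ∧
    (∀ a ∈ ι.lieAlg, ∀ b c : Mat n,
      frobeniusForm n (opP β 𝔞.toSubmodule a c) b
        = frobeniusForm n c (opPAdj β 𝔞.toSubmodule a b)) ∧
    -- the operator `P_a` is antisymmetric for the form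
    (∀ a ∈ ι.lieAlg, ∀ b ∈ ι.lieAlg, ∀ c ∈ ι.lieAlg,
      betaForm β₀ β₁ 𝔞.toSubmodule (opP β 𝔞.toSubmodule a b) c
        + betaForm β₀ β₁ 𝔞.toSubmodule (opP β 𝔞.toSubmodule a c) b = 0) := by
  have hβ₀ : β₀ ≠ 0 := left_ne_zero_of_mul hβ₀₁
  have hβ' : β₀ * β = β₁ := by rw [hβ, mul_div_cancel₀ _ hβ₀]
  have hsep : ∀ g ∈ ι.lieAlg, (∀ x ∈ ι.lieAlg, betaForm β₀ β₁ 𝔞.toSubmodule g x = 0) → g = 0 :=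
    fun g hg h => betaForm_separating hβ₀₁ h𝔤 h𝔞𝔤 h𝔞 hg h
  have hm := ι.isPseudoRiemannianMetric_leftInvMetric (betaForm_symm β₀ β₁ 𝔞.toSubmodule) hsep
  have hLC := ι.isLeviCivita_christoffel h𝔞𝔤 h𝔞 hβ'
  have hbow : ∀ a ∈ ι.lieAlg, ∀ b ∈ ι.lieAlg,
      ⁅proj 𝔞.toSubmodule a, b⁆ + ⁅proj 𝔞.toSubmodule b, a⁆ ∈ bowtie ι.lieAlg 𝔞.toSubmodule :=
    fun a ha b hb => lie_proj_add_mem_bowtie h𝔞𝔤 h𝔞 ha hb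
  refine ⟨⟨fun a b => betaForm_symm β₀ β₁ 𝔞.toSubmodule a b⟩, ⟨fun a h => ?_, fun a h => ?_⟩, hm,
    ι.isLeftInvariant_leftInvMetric _, fun nab => ⟨fun h Y Z hY hZ => ?_, fun h => ?_⟩, hbow,
    fun X ξ hξ η hη => ?_, fun X ξ hξ a ha => ?_, fun a ha b hb => ⟨?_, ?_⟩,
    fun a _ b c => frobeniusForm_opP β 𝔞.toSubmodule a b c,
    fun a _ b _ c _ => betaForm_opP hβ' h𝔞 a b c⟩
  · exact Subtype.ext (hsep a a.2 fun x hx => h ⟨x, hx⟩)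
  · exact Subtype.ext (hsep a a.2 fun x hx => (betaForm_symm _ _ _ _ _).trans (h ⟨x, hx⟩))
  · exact h.unique hm hLC hY hZ
  · exact hLC.congr h
  · refine ⟨((1 + β) / 2) • _, Submodule.smul_mem _ _
      (hbow _ (ι.inv_mul_mem_lieAlg hξ) _ (ι.inv_mul_mem_lieAlg hη)), ?_⟩
    rw [MatrixLieGroup.christoffelTail, mul_smul_comm]
  · have ha' : a ∈ ι.lieAlg := ha ▸ ι.inv_mul_mem_lieAlg hξ
    have hξa : ι.mat X * a = ξ := by rw [ha, ι.mat_mul_inv_cancel_left]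
    obtain ⟨γ, hs, hγ⟩ := ι.exists_curve_eq X h𝔞𝔤 β ha'
    simp only [mul_smul]
    have h0 : ι.curve γ 0 = ι.mat X := by simp [hγ]
    refine ⟨γ, ι.isGeodesicOn_of_curve_eq h𝔞𝔤 h𝔞 hβ' hs hγ, ι.mat_injective h0, ?_, hγ, ?_, ?_⟩
    · rw [(ι.hasDerivAt_curve_of_eq hγ 0).deriv, h0, neg_zero, expConj_zero, hξa]
    · intro J hJ hJ' h0J γ' hγ' hX hξ' t ht
      refine ι.mat_injective (Eq.trans ?_ (hγ t).symm)
      rw [← hX]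
      exact ι.curve_eq_of_isGeodesicOn hm h𝔞𝔤 h𝔞 hβ' hJ hJ' h0J hγ' (by rw [hX, hξ', ha]) ht
    · intro η hη t ζ
      constructor
      · rintro ⟨J, hJ, hJ', h0J, ht, Δ, hΔ, rfl, rfl⟩
        exact ι.eq_of_isParallelOn hm h𝔞𝔤 h𝔞 hβ' hs hγ hJ hJ' h0J hΔ ht
      · rintro rfl
        -- A single field defined for all times serves every `t`.
        refine ⟨univ, isOpen_univ, ordConnected_univ, mem_univ _, mem_univ _, _,
          ι.exists_isParallelOn h𝔞𝔤 h𝔞 hβ' ha' hγ (ι.inv_mul_mem_lieAlg hη), ?_, rfl⟩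
        rw [expAct_zero_smul]
        simp only [zero_smul, NormedSpace.exp_zero, mul_one, ι.mat_mul_inv_cancel_left]
  · rw [opP_eq]
    exact ι.lieAlg.sub_mem (ι.lieAlg.smul_mem _ (ι.lie_mem_lieAlg (h𝔞𝔤 (proj_mem _ _)) hb))
      (ι.opL_mem β h𝔞𝔤 ha hb)
  -- The adjoint involves `aᵀ`, which lies in the Lie algebra by transposability.
  · have h1 := ι.lie_mem_lieAlg hb (transpose_mem h𝔤 ha)
    exact ι.lieAlg.smul_mem _ (ι.lieAlg.add_mem h1 (ι.lieAlg.smul_mem _ (ι.lieAlg.sub_mem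
      (ι.lie_mem_lieAlg (h𝔞𝔤 (transpose_mem h𝔞 (proj_mem _ _))) hb) (h𝔞𝔤 (proj_mem _ _)))))
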